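/- All graphs are finite and simple (no loops). For graphs $G,H$, a partial $H$-coloring of $G$ is a partial function $\phi\colon V(G)\rightharpoonup V(H)$ that is a homomorphism to $H$ from the subgraph of $G$ induced by $\mathrm{dom}\,\phi$. For a fixed graph $H$, the problem Max Partial $H$-Coloring is: given a graph $G$ and a revenue function $\mathrm{rev}\colon V(G)\times V(H)\to\mathbb{R}$, output a partial $H$-coloring $\phi$ of $G$ that maximizes $\mathrm{rev}(\phi)=\sum_{u\in \mathrm{dom}\,\phi}\mathrm{rev}(u,\phi(u))$. It can be solved in polynomial time in a class of graphs if there is an algorithm that outputs an optimum solution for every instance $(G,\mathrm{rev})$ with $G$ in the class, in a number of steps bounded by a polynomial in $|V(G)|$; here one step is an elementary operation of a pointer machine (while-programs over cons cells), which may also add, subtract or compare two real numbers, the only real constant available being $1$. Let $P_6$ be the path on $6$ vertices. For $t\in\mathbb{N}$ let $S_t$ be the graph obtained from the star $K_{1,t}$ by subdividing every edge once, and for $s\in\mathbb{N}$ let $L_s$ be the graph obtained from $S_s$ by making all its leaves (the $s$ end vertices of the subdivided edges) pairwise adjacent; thus $L_1=P_3$ and $L_0=S_0=K_1$. For a graph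 $F$ let $\mathrm{antenna}(F)$ be the graph obtained from $F$ by first adding an isolated vertex and then adding a vertex adjacent to all other vertices. A graph is $\mathcal{F}$-free if none of its induced subgraphs is isomorphic to a member of $\mathcal{F}$. **Theorem.** Fix $s,t\in\mathbb{N}$. Suppose $F$ is a connected graph on at least two vertices such that for every fixed graph $H$, Max Partial $H$-Coloring can be solved in polynomial time in $\{P_6,L_s,S_t,F\}$-free graphs. Then for every fixed graph $H$, Max Partial $H$-Coloring can be solved in polynomial time in $\{P_6,L_s,S_t,\mathrm{antenna}(F)\}$-free graphs. -/

import Mathlib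

/-! ## Graphs -/

/-- The `1`-subdivided star `S_t`: centre `none`, the `i`-th subdivision vertex `some (i, false)`
adjacent to the centre, and the `i`-th leaf `some (i, true)` adjacent to the `i`-th subdivision
vertex. -/
def subdividedStar (t : ℕ) : SimpleGraph (Option (Fin t × Bool)) where
  Adj
    | none, some (_, b) => b = false
    | some (_, b), none => b = false
    | some (i, b), some (j, c) => i = j ∧ b ≠ c
    | none, none => False
  symm := ⟨by
    rintro (_ | ⟨i, b⟩) (_ | ⟨j, c⟩) h
    · exact h
    · exact h
    · exact h
    · exact ⟨h.1.symm, h.2.symm⟩⟩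
  loopless := ⟨by
    rintro (_ | ⟨i, b⟩) h
    · exact h
    · exact h.2 rfl⟩

/-- The graph `L_s`: the graph `S_s` with all its leaves made pairwise adjacent
(`L_1 = S_1` is the path on three vertices). -/
def leafCliqueStar (s : ℕ) : SimpleGraph (Option (Fin s × Bool)) :=
  subdividedStar s ⊔
    SimpleGraph.fromRel (fun a b => ∃ i j : Fin s, a = some (i, true) ∧ b = some (j, true))

/-- `F` together with a new isolated vertex `none`. -/
def addIsolated {V : Type*} (F : SimpleGraph V) : SimpleGraph (Option V) :=
  F.map Function.Embedding.some

/-- `F` together with a new vertex `none` adjacent to all other vertices. -/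
def addUniversal {V : Type*} (F : SimpleGraph V) : SimpleGraph (Option V) :=
  F.map Function.Embedding.some ⊔ SimpleGraph.fromRel (fun a _ => a = none)

/-- The antenna of `F`: first add an isolated vertex, then a universal vertex. -/
def antenna {V : Type*} (F : SimpleGraph V) : SimpleGraph (Option (Option V)) :=
  addUniversal (addIsolated F)

/-- `G` has no induced subgraph isomorphic to `P_6`, `L_s`, `S_t` or `F`. -/
def ForbidFree (s t : ℕ) {VF : Type*} (F : SimpleGraph VF) {V : Type*} (G : SimpleGraph V) :
    Prop :=
  ¬ (SimpleGraph.pathGraph 6).IsIndContained G ∧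
  ¬ (leafCliqueStar s).IsIndContained G ∧
  ¬ (subdividedStar t).IsIndContained G ∧
  ¬ F.IsIndContained G

/-! ## Partial `H`-colorings -/

/-- A partial function `φ : V ⇀ W` is a partial `H`-coloring of `G` if it is a homomorphism to `H`
from the subgraph of `G` induced by its domain. -/
def IsPartialColoring {V W : Type*} (G : SimpleGraph V) (H : SimpleGraph W) (φ : V → Option W) :
    Prop :=
  ∀ u v : V, ∀ a b : W, φ u = some a → φ v = some b → G.Adj u v → H.Adj a b

/-- The revenue of a partial coloring: the sum of `rev u (φ u)` over all `u` in the domain. -/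
noncomputable def revenue {V W : Type*} [Fintype V] (rev : V → W → ℝ) (φ : V → Option W) : ℝ :=
  ∑ u, (φ u).elim 0 (rev u)

/-- `φ` is an optimum solution to the instance `(G, rev)` of Max Partial `H`-Coloring. -/
def IsOptimumSolution {V W : Type*} [Fintype V] (G : SimpleGraph V) (H : SimpleGraph W)
    (rev : V → W → ℝ) (φ : V → Option W) : Prop :=
  IsPartialColoring G H φ ∧
  ∀ ψ : V → Option W, IsPartialColoring G H ψ → revenue rev ψ ≤ revenue rev φ

/-! ## The model of computation

Programs manipulate list structures: binary trees whose leaves are `nil` or real numbers. This is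
a pointer machine (a structured while-language over cons cells) with a real arithmetic unit that
can add, subtract and compare. Each elementary operation handles a bounded number of pointers or
real numbers and costs one step. The only real constant available is `1`, so programs are finite
objects that hide no information in real constants. -/

/-- The data. The value `nil` plays the role of "false"; every other value counts as "true". -/
inductive Val : Type
  | nil : Val
  | num : ℝ → Val
  | pair : Val → Val → Val

/-- The elementary operations. -/
inductive Prim : Type
  | id | nil | one | fst | snd | add | sub | le

open Classical in
/-- The effect of an elementary operation; binary ones take their arguments as a pair, and an
operation applied to a value of the wrong form yields `nil`. -/
noncomputable def Prim.eval : Prim → Val → Val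
  | .id, v => v
  | .nil, _ => .nil
  | .one, _ => .num 1
  | .fst, .pair a _ => a
  | .snd, .pair _ b => b
  | .add, .pair (.num x) (.num y) => .num (x + y)
  | .sub, .pair (.num x) (.num y) => .num (x - y)
  | .le, .pair (.num x) (.num y) => if x ≤ y then .pair .nil .nil else .nil
  | _, _ => .nil

/-- Programs; each one maps a value to a value. -/
inductive Prog : Type
  /-- perform an elementary operation -/
  | prim : Prim → Prog
  /-- run the first program, then the second on its result -/
  | seq : Prog → Prog → Prog
  /-- run both programs on the input and form the pair of the results -/
  | pair : Prog → Prog → Prog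
  /-- run the test on the input, then on the input the first branch if the result is "true" and
  the second one otherwise -/
  | cond : Prog → Prog → Prog → Prog
  /-- `loop t f`: while the test `t` is "true" on the current value, replace that value by the
  result of `f` on it -/
  | loop : Prog → Prog → Prog

/-- `Runs P v w T`: on input `v` the program `P` halts with output `w` after exactly `T` steps. -/
inductive Runs : Prog → Val → Val → ℕ → Prop
  | prim (o : Prim) (v : Val) : Runs (.prim o) v (o.eval v) 1
  | seq {P Q : Prog} {u v w : Val} {m n : ℕ} :
      Runs P u v m → Runs Q v w n → Runs (.seq P Q) u w (m + n + 1)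
  | pair {P Q : Prog} {u v w : Val} {m n : ℕ} :
      Runs P u v m → Runs Q u w n → Runs (.pair P Q) u (.pair v w) (m + n + 1)
  | condTrue {C P Q : Prog} {u c v : Val} {m n : ℕ} :
      Runs C u c m → c ≠ .nil → Runs P u v n → Runs (.cond C P Q) u v (m + n + 1)
  | condFalse {C P Q : Prog} {u v : Val} {m n : ℕ} :
      Runs C u .nil m → Runs Q u v n → Runs (.cond C P Q) u v (m + n + 1)
  | loopDone {C P : Prog} {u : Val} {m : ℕ} :
      Runs C u .nil m → Runs (.loop C P) u u (m + 1)
  | loopStep {C P : Prog} {u c v w : Val} {l m n : ℕ} :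
      Runs C u c l → c ≠ .nil → Runs P u v m → Runs (.loop C P) v w n →
      Runs (.loop C P) u w (l + m + n + 1)

/-! ## Encodings and polynomial-time solvability -/

/-- A list of values as a chain of pairs ended by `nil`. -/
def encodeList : List Val → Val
  | [] => .nil
  | a :: l => .pair a (encodeList l)

/-- Natural numbers in unary. -/
def encodeNat : ℕ → Val
  | 0 => .nil
  | n + 1 => .pair .nil (encodeNat n)

open Classical in
/-- The truth value of a proposition: `false` is `nil`, and `true` is `pair nil nil`. -/
noncomputable def encodeProp (p : Prop) : Val :=
  if p then .pair .nil .nil else .nil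

/-- An instance `(G, rev)` as the list of its `n` vertices; the entry of a vertex `u` is the pair
of row `u` of the adjacency matrix and the list of the revenues of the assignments to `u`. -/
noncomputable def encodeInstance {n k : ℕ} (G : SimpleGraph (Fin n)) (rev : Fin n → Fin k → ℝ) :
    Val :=
  encodeList (List.ofFn fun u : Fin n =>
    .pair (encodeList (List.ofFn fun v : Fin n => encodeProp (G.Adj u v)))
      (encodeList (List.ofFn fun c : Fin k => .num (rev u c))))

/-- A partial coloring as the list of the colors of the vertices: `0` for an uncolored vertex and
`c + 1` for a vertex of color `c`. -/
def encodeColoring {n k : ℕ} (φ : Fin n → Option (Fin k)) : Val :=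
  encodeList (List.ofFn fun u : Fin n => encodeNat ((φ u).elim 0 fun c => c.val + 1))

/-- Max Partial `H`-Coloring can be solved in polynomial time in the graphs of the class `𝒞`:
some program outputs, for every instance `(G, rev)` with `G` in `𝒞`, an optimum solution within a
number of steps polynomial in the number of vertices of `G`. -/
def SolvableInPolyTime {k : ℕ} (H : SimpleGraph (Fin k))
    (𝒞 : ∀ n : ℕ, SimpleGraph (Fin n) → Prop) : Prop :=
  ∃ (P : Prog) (p : Polynomial ℕ), ∀ (n : ℕ) (G : SimpleGraph (Fin n)) (rev : Fin n → Fin k → ℝ),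
    𝒞 n G → ∃ (φ : Fin n → Option (Fin k)) (T : ℕ), IsOptimumSolution G H rev φ ∧
      Runs P (encodeInstance G rev) (encodeColoring φ) T ∧ T ≤ p.eval n

/-! ## Polynomial-time computable functions

`PT N e g` says that one program computes `g x` from `e x`, for all `x`, in time polynomial in
`N x`. -/

/-! Forbidding by revenue. An optimum never needs assignments of negative revenue, so giving revenue
`-1` to an assignment forbids it while leaving the graph, and hence its class, unchanged
(`Inst.mask`). A vertex is active, and a color live, if some assignment of nonnegative revenue
involves it. The algorithm recurses on the number of live colors, which is at most `k`.

Decoupling. Let `A` lie between the open and the closed neighbourhood of a vertex `q`, and let `χ`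
be an optimum. Each color class of `χ` inside `A` is independent because `H` has no loops. A minimal
subset of it that dominates its neighbours outside `A` has private neighbours. If it were large,
Ramsey's theorem would find among these a clique, giving an induced `L_s`, or an independent set,
giving an induced `S_t` (`exists_small_dominating`). So boundedly many assignments of `χ` already
determine which colors every active vertex outside `A` sees in `A` (`Inst.exists_announcement`).
After trying all such bounded lists, the edges leaving `A` are accounted for by two masks, and the
two sides are solved independently (`Inst.safe_combine`, `Inst.opt_combine`).

Stars (`exists_star_solver`). Suppose all active vertices lie in the closed neighbourhood of `p`.
Guess a vertex `q` colored by the optimum, together with its color `c`, and decouple the open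
neighbourhood of `q`. Inside it, `c` cannot occur, so one live color is lost and the recursion
applies. Outside it, an induced `F` would form with `p` and `q` an antenna of `F`, so the assumed
algorithm applies (`forbidFree_within`).

Peeling (`exists_peeling_solver`). By Gyárfás' path argument, a `P_6`-free graph is exhausted by
five rounds of passing to components and deleting a closed neighbourhood (`peelable_of_forall`). In
each round the centre `p` is guessed and its closed neighbourhood decoupled. The star solver treats
the inside, the remaining rounds treat the outside, and the components are solved separately.

Running time. `PT` is closed under composition, branching and polynomially long loops, so every
guess is a loop that keeps the best candidate. The nesting depth depends only on `k`, `s` and `t`,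
which keeps the time polynomial. -/

open Polynomial in
theorem Polynomial.eval_nat_mono (p : ℕ[X]) : Monotone fun n : ℕ => p.eval n := by
  intro a b hab
  induction p using Polynomial.induction_on' with
  | add p q hp hq => simpa using add_le_add hp hq
  | monomial n c => simpa using Nat.mul_le_mul_left c (Nat.pow_le_pow_left hab n)

/-- One program computes `g x` from `e x` in time polynomial in `N x`. -/
def PT {X : Type*} (N : X → ℕ) (e g : X → Val) : Prop :=
  ∃ (P : Prog) (p : Polynomial ℕ), ∀ x, ∃ T, Runs P (e x) (g x) T ∧ T ≤ p.eval (N x)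

/-- `b` can be decided in polynomial time. -/
def PD {X : Type*} (N : X → ℕ) (e : X → Val) (b : X → Prop) : Prop :=
  PT N e fun x => encodeProp (b x)

/-- `n` is polynomially bounded in `N`. -/
def PB {X : Type*} (N n : X → ℕ) : Prop :=
  ∃ p : Polynomial ℕ, ∀ x, n x ≤ p.eval (N x)

theorem encodeProp_ne_nil {p : Prop} : encodeProp p ≠ Val.nil ↔ p := by
  by_cases h : p <;> simp [encodeProp, h]

theorem encodeProp_true {p : Prop} (h : p) : encodeProp p = .pair .nil .nil := by
  simp [encodeProp, h]

theorem encodeProp_false {p : Prop} (h : ¬ p) : encodeProp p = .nil := by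
  simp [encodeProp, h]

namespace PB

variable {X Y : Type*} {N n : X → ℕ}

theorem of_le (h : ∀ x, n x ≤ N x) : PB N n := ⟨Polynomial.X, by simpa using h⟩

theorem const (N : X → ℕ) (c : ℕ) : PB N fun _ => c := ⟨Polynomial.C c, by simp⟩

theorem reindex (h : PB N n) (φ : Y → X) : PB (fun y => N (φ y)) fun y => n (φ y) :=
  h.imp fun _ hp y => hp (φ y)

end PB

namespace PT

variable {X Y : Type*} {N : X → ℕ} {e f g h : X → Val}

theorem congr (hg : PT N e g) (hgh : ∀ x, g x = h x) : PT N e h := by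
  rwa [← funext hgh]

theorem prim (N : X → ℕ) (e : X → Val) (o : Prim) : PT N e fun x => o.eval (e x) :=
  ⟨.prim o, 1, fun x => ⟨1, .prim o _, by simp⟩⟩

theorem id (N : X → ℕ) (e : X → Val) : PT N e e := prim N e .id

theorem nil (N : X → ℕ) (e : X → Val) : PT N e fun _ => .nil := prim N e .nil

theorem one (N : X → ℕ) (e : X → Val) : PT N e fun _ => .num 1 := prim N e .one

theorem comp (hf : PT N e f) (hg : PT N f g) : PT N e g := by
  obtain ⟨P, p, hP⟩ := hf
  obtain ⟨Q, q, hQ⟩ := hg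
  refine ⟨.seq P Q, p + q + 1, fun x => ?_⟩
  obtain ⟨T, hT, hTp⟩ := hP x
  obtain ⟨U, hU, hUq⟩ := hQ x
  exact ⟨_, .seq hT hU, by simp; omega⟩

theorem pair (hf : PT N e f) (hg : PT N e g) : PT N e fun x => .pair (f x) (g x) := by
  obtain ⟨P, p, hP⟩ := hf
  obtain ⟨Q, q, hQ⟩ := hg
  refine ⟨.pair P Q, p + q + 1, fun x => ?_⟩
  obtain ⟨T, hT, hTp⟩ := hP x
  obtain ⟨U, hU, hUq⟩ := hQ x
  exact ⟨_, .pair hT hU, by simp; omega⟩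

theorem fst (N : X → ℕ) (f g : X → Val) : PT N (fun x => .pair (f x) (g x)) f :=
  prim N (fun x => .pair (f x) (g x)) .fst

theorem snd (N : X → ℕ) (f g : X → Val) : PT N (fun x => .pair (f x) (g x)) g :=
  prim N (fun x => .pair (f x) (g x)) .snd

theorem head (hg : PT N e fun x => .pair (f x) (g x)) : PT N e f := hg.comp (fst N f g)

theorem tail (hg : PT N e fun x => .pair (f x) (g x)) : PT N e g := hg.comp (snd N f g)

theorem reindex (hg : PT N e g) (φ : Y → X) : PT (fun y => N (φ y)) (fun y => e (φ y))
    fun y => g (φ y) := by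
  obtain ⟨P, p, hP⟩ := hg
  exact ⟨P, p, fun y => hP (φ y)⟩

/-- What can be computed from the context can be computed from the context and further data. -/
theorem weaken (hg : PT N e g) (φ : Y → X) (w : Y → Val) :
    PT (fun y => N (φ y)) (fun y => .pair (e (φ y)) (w y)) fun y => g (φ y) :=
  (fst _ _ _).comp (hg.reindex φ)

/-- Calling a subroutine. -/
theorem call {M : Y → ℕ} {a b : Y → Val} (hg : PT M a b) {φ : X → Y}
    (hf : PT N e fun x => a (φ x)) (hM : ∀ x, M (φ x) ≤ N x) : PT N e fun x => b (φ x) := by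
  refine hf.comp ?_
  obtain ⟨P, p, hP⟩ := hg
  refine ⟨P, p, fun x => ?_⟩
  obtain ⟨T, hT, hTp⟩ := hP (φ x)
  exact ⟨T, hT, hTp.trans (p.eval_nat_mono (hM x))⟩

open Classical in
theorem ite {b : X → Prop} (hb : PD N e b) (hf : PT N e f) (hg : PT N e g) :
    PT N e fun x => if b x then f x else g x := by
  obtain ⟨C, c, hC⟩ := hb
  obtain ⟨P, p, hP⟩ := hf
  obtain ⟨Q, q, hQ⟩ := hg
  refine ⟨.cond C P Q, c + p + q + 1, fun x => ?_⟩
  obtain ⟨S, hS, hSc⟩ := hC x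
  obtain ⟨T, hT, hTp⟩ := hP x
  obtain ⟨U, hU, hUq⟩ := hQ x
  by_cases hx : b x
  · simp only [if_pos hx]
    exact ⟨_, .condTrue hS (encodeProp_ne_nil.2 hx) hT, by simp; omega⟩
  · simp only [if_neg hx]
    simp only [encodeProp_false hx] at hS
    exact ⟨_, .condFalse hS hU, by simp; omega⟩

theorem encodeNat_const (N : X → ℕ) (e : X → Val) (c : ℕ) : PT N e fun _ => encodeNat c := by
  induction c with
  | zero => exact nil N e
  | succ c ih => exact (nil N e).pair ih

theorem encodeNat_pred {i : X → ℕ} (hi : PT N e fun x => encodeNat (i x)) :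
    PT N e fun x => encodeNat (i x - 1) :=
  (hi.comp (prim _ _ .snd)).congr fun x => by cases i x <;> rfl

end PT

namespace PD

variable {X Y : Type*} {N : X → ℕ} {e : X → Val} {a b : X → Prop}

theorem congr (ha : PD N e a) (hab : ∀ x, a x ↔ b x) : PD N e b :=
  PT.congr ha fun x => by rw [hab x]

theorem const (N : X → ℕ) (e : X → Val) (p : Prop) : PD N e fun _ => p := by
  by_cases hp : p
  · exact ((PT.nil N e).pair (PT.nil N e)).congr fun _ => (encodeProp_true hp).symm
  · exact (PT.nil N e).congr fun _ => (encodeProp_false hp).symm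

theorem not (ha : PD N e a) : PD N e fun x => ¬ a x :=
  (PT.ite ha (const N e False) (const N e True)).congr fun x => by
    by_cases h : a x <;> simp [h]

theorem and (ha : PD N e a) (hb : PD N e b) : PD N e fun x => a x ∧ b x :=
  (PT.ite ha hb (const N e False)).congr fun x => by
    by_cases h : a x <;> simp [h]

theorem or (ha : PD N e a) (hb : PD N e b) : PD N e fun x => a x ∨ b x :=
  (PT.ite ha (const N e True) hb).congr fun x => by
    by_cases h : a x <;> simp [h]

theorem imp (ha : PD N e a) (hb : PD N e b) : PD N e fun x => a x → b x :=
  (ha.not.or hb).congr fun x => by tauto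

theorem ne_nil {f : X → Val} (hf : PT N e f) : PD N e fun x => f x ≠ .nil := by
  obtain ⟨P, p, hP⟩ := hf
  obtain ⟨Q, q, hQ⟩ := const N e True
  obtain ⟨R, r, hR⟩ := const N e False
  refine ⟨.cond P Q R, p + q + r + 1, fun x => ?_⟩
  obtain ⟨S, hS, hSc⟩ := hP x
  obtain ⟨T, hT, hTp⟩ := hQ x
  obtain ⟨U, hU, hUq⟩ := hR x
  by_cases hx : f x = .nil
  · have h1 := encodeProp_false (p := f x ≠ .nil) (by simpa using hx)
    have h2 := encodeProp_false (p := False) (by simp)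
    simp only [hx, h2] at hS hU
    simp only [h1]
    exact ⟨_, .condFalse hS hU, by simp; omega⟩
  · have h1 := encodeProp_true (p := f x ≠ .nil) hx
    have h2 := encodeProp_true (p := True) trivial
    simp only [h2] at hT
    simp only [h1]
    exact ⟨_, .condTrue hS hx hT, by simp; omega⟩

theorem le {r t : X → ℝ} (hr : PT N e fun x => .num (r x)) (ht : PT N e fun x => .num (t x)) :
    PD N e fun x => r x ≤ t x :=
  ((hr.pair ht).comp (PT.prim _ _ .le)).congr fun x => by simp [Prim.eval, encodeProp]

end PD

/-! ### Loops over indices and operations on lists. -/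

namespace PT

variable {X Y : Type*} {N : X → ℕ} {e f g h : X → Val}

theorem add {r t : X → ℝ} (hr : PT N e fun x => .num (r x)) (ht : PT N e fun x => .num (t x)) :
    PT N e fun x => .num (r x + t x) :=
  (hr.pair ht).comp (prim _ _ .add)

theorem zero (N : X → ℕ) (e : X → Val) : PT N e fun _ => .num 0 :=
  (((one N e).pair (one N e)).comp (prim _ _ .sub)).congr fun x => by simp [Prim.eval]

theorem neg_one (N : X → ℕ) (e : X → Val) : PT N e fun _ => .num (-1) :=
  (((zero N e).pair (one N e)).comp (prim _ _ .sub)).congr fun x => by simp [Prim.eval]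

/-- The while loop over `Fin (n x)`, from the last index to the first one, with a state. -/
theorem foldr {n : X → ℕ} {S : X → Type*} {enc : ∀ x, S x → Val}
    {step : ∀ x, Fin (n x) → S x → S x} {init : ∀ x, S x}
    (hn : PT N e fun x => encodeNat (n x)) (hnN : PB N n)
    (h0 : PT N e fun x => enc x (init x))
    (hs : PT (X := Σ x, Fin (n x) × S x) (fun y => N y.1)
      (fun y => .pair (e y.1) (.pair (encodeNat y.2.1) (enc y.1 y.2.2)))
      fun y => enc y.1 (step y.1 y.2.1 y.2.2)) :
    PT N e fun x => enc x ((List.finRange (n x)).foldr (step x) (init x)) := by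
  have start := (PT.id N e).pair (hn.pair h0)
  refine start.comp (PT.comp ?_ ((snd N e _).comp (snd N (fun _ => Val.nil) _)))
  obtain ⟨q, hq⟩ := hnN
  obtain ⟨P, p, hP⟩ := hs
  -- The loop acts on (context, (unary counter, state)). A round decrements the counter and hands
  -- the new value to `P` as the index, so the indices come as `n - 1, …, 0`, the order in which
  -- `foldr` consumes `List.finRange`. The final test costs `4`, and `26` covers the overhead of a
  -- round.
  refine ⟨.loop (.seq (.prim .snd) (.prim .fst))
    (.pair (.prim .fst) (.pair (.seq (.prim .snd) (.seq (.prim .fst) (.prim .snd)))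
      (.seq (.pair (.prim .fst) (.pair (.seq (.prim .snd) (.seq (.prim .fst) (.prim .snd)))
        (.seq (.prim .snd) (.prim .snd)))) P))), q * (p + 26) + 4, fun x => ?_⟩
  have key : ∀ i ≤ n x, ∀ s : S x, ∃ T,
      Runs (.loop (.seq (.prim .snd) (.prim .fst))
        (.pair (.prim .fst) (.pair (.seq (.prim .snd) (.seq (.prim .fst) (.prim .snd)))
        (.seq (.pair (.prim .fst) (.pair (.seq (.prim .snd) (.seq (.prim .fst) (.prim .snd)))
        (.seq (.prim .snd) (.prim .snd)))) P))))
        (.pair (e x) (.pair (encodeNat i) (enc x s)))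
        (.pair (e x) (.pair .nil (enc x (((List.finRange (n x)).take i).foldr (step x) s)))) T ∧
      T ≤ i * (p.eval (N x) + 26) + 4 := by
    intro i
    induction i with
    | zero =>
      intro _ s
      refine ⟨_, .loopDone (.seq (.prim _ _) (.prim _ _)), by omega⟩
    | succ i ih =>
      intro hi s
      obtain ⟨T, hT, hTp⟩ := hP ⟨x, ⟨i, hi⟩, s⟩
      obtain ⟨U, hU, hUp⟩ := ih (by omega) (step x ⟨i, hi⟩ s)
      have e1 : ((List.finRange (n x)).take (i + 1)).foldr (step x) s =
          ((List.finRange (n x)).take i).foldr (step x) (step x ⟨i, hi⟩ s) := by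
        rw [List.take_add_one, List.foldr_append]
        have : (List.finRange (n x))[i]? = some ⟨i, hi⟩ := by
          rw [List.getElem?_eq_getElem (by simpa using hi)]; simp
        rw [this]; rfl
      rw [e1]
      refine ⟨_, .loopStep (c := .pair .nil (encodeNat i)) (.seq (.prim _ _) (.prim _ _)) (by simp)
        (.pair (.prim _ _) (.pair (.seq (.prim _ _) (.seq (.prim _ _) (.prim _ _)))
          (.seq (.pair (.prim _ _) (.pair (.seq (.prim _ _) (.seq (.prim _ _) (.prim _ _)))
            (.seq (.prim _ _) (.prim _ _)))) hT))) hU, ?_⟩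
      dsimp only at hTp
      rw [add_mul]
      omega
  obtain ⟨T, hT, hTp⟩ := key (n x) le_rfl (init x)
  rw [List.take_of_length_le (by simp)] at hT
  refine ⟨T, hT, hTp.trans ?_⟩
  simp only [Polynomial.eval_add, Polynomial.eval_mul, Polynomial.eval_ofNat]
  gcongr
  exact hq x

/-- The context extended by an index. -/
abbrev withFin (e : X → Val) (n : X → ℕ) : (Σ x, Fin (n x)) → Val :=
  fun y => .pair (e y.1) (encodeNat y.2)

theorem last (e : X → Val) (n : X → ℕ) (N : (Σ x, Fin (n x)) → ℕ) :
    PT N (withFin e n) fun y => encodeNat y.2 :=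
  snd _ _ _

theorem withState {n : X → ℕ} {S : X → Type*} {enc : ∀ x, S x → Val}
    {k : (Σ x, Fin (n x)) → Val} (hk : PT (fun y => N y.1) (withFin e n) k) :
    PT (X := Σ x, Fin (n x) × S x) (fun y => N y.1)
      (fun y => .pair (e y.1) (.pair (encodeNat y.2.1) (enc y.1 y.2.2)))
      fun y => k ⟨y.1, y.2.1⟩ :=
  PT.comp (f := fun y => .pair (e y.1) (encodeNat y.2.1))
    ((fst _ _ _).pair ((snd _ _ _).comp (fst _ _ _)))
    (hk.reindex fun y : Σ x, Fin (n x) × S x => (⟨y.1, y.2.1⟩ : Σ x, Fin (n x)))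

theorem state {n : X → ℕ} {S : X → Type*} {enc : ∀ x, S x → Val} :
    PT (X := Σ x, Fin (n x) × S x) (fun y => N y.1)
      (fun y => .pair (e y.1) (.pair (encodeNat y.2.1) (enc y.1 y.2.2)))
      fun y => enc y.1 y.2.2 :=
  (snd _ _ _).comp (snd _ _ _)

theorem tabulate {n : X → ℕ} {v : ∀ x, Fin (n x) → Val}
    (hn : PT N e fun x => encodeNat (n x)) (hnN : PB N n)
    (hv : PT (fun y => N y.1) (withFin e n) fun y => v y.1 y.2) :
    PT N e fun x => encodeList (List.ofFn (v x)) := by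
  refine (foldr (S := fun _ => List Val) (enc := fun _ => encodeList)
    (step := fun x i l => v x i :: l) (init := fun _ => []) hn hnN (nil N e)
    ((withState (S := fun _ => List Val) (enc := fun _ => encodeList) hv).pair
      (state (S := fun _ => List Val) (enc := fun _ => encodeList)))).congr fun x => ?_
  rw [List.ofFn_eq_map]
  congr 1
  generalize List.finRange (n x) = l
  induction l with
  | nil => rfl
  | cons a l ih => simp [ih]

/-- Take the tail `i` times, then the head. The polynomial bound on `n` also bounds `i`, the number
of rounds. -/
theorem nth {n : X → ℕ} {v : ∀ x, Fin (n x) → Val} {i : ∀ x, Fin (n x)} (hnN : PB N n)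
    (hv : PT N e fun x => encodeList (List.ofFn (v x)))
    (hi : PT N e fun x => encodeNat (i x)) : PT N e fun x => v x (i x) := by
  have hb : PB N fun x => (i x : ℕ) := hnN.imp fun p hp x => (i x).2.le.trans (hp x)
  have := (foldr (S := fun _ => Val) (enc := fun _ => _root_.id)
    (step := fun x _ l => Prim.snd.eval l) hi hb hv
    (PT.comp (state (S := fun _ => Val) (enc := fun _ => _root_.id)) (prim _ _ .snd))).comp
      (prim _ _ .fst)
  refine this.congr fun x => ?_
  have key : ∀ (l : List Val) (m : List (Fin (i x))) (h : m.length < l.length),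
      Prim.fst.eval (m.foldr (fun _ l => Prim.snd.eval l) (encodeList l)) = l[m.length] := by
    intro l m
    have : ∀ l : List Val, m.foldr (fun _ l => Prim.snd.eval l) (encodeList l) =
        encodeList (l.drop m.length) := by
      induction m with
      | nil => simp
      | cons a m ih =>
        intro l
        rw [List.foldr_cons, ih, List.length_cons, ← List.drop_drop]
        cases l.drop m.length <;> rfl
    intro h
    rw [this, List.drop_eq_getElem_cons h]
    rfl
  have := key (List.ofFn (v x)) (List.finRange (i x)) (by simp)
  simpa using this

/-- The length of a list, in unary. -/
theorem length {l : X → List Val} (hl : PT N e fun x => encodeList (l x))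
    (hb : PB N fun x => (l x).length) : PT N e fun x => encodeNat (l x).length := by
  -- `foldr` needs a unary counter, which is what is being computed here. Hence a direct loop on
  -- (rest of the list, number of entries seen).
  refine (hl.pair (nil N e)).comp (PT.comp (f := fun x => .pair .nil (encodeNat (l x).length)) ?_
    (snd N (fun _ => Val.nil) _))
  obtain ⟨q, hq⟩ := hb
  refine ⟨.loop (.prim .fst) (.pair (.seq (.prim .fst) (.prim .snd))
    (.pair (.prim .nil) (.prim .snd))), q * 20 + 2, fun x => ?_⟩
  have key : ∀ (l : List Val) (a : ℕ), ∃ T,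
      Runs (.loop (.prim .fst) (.pair (.seq (.prim .fst) (.prim .snd))
        (.pair (.prim .nil) (.prim .snd)))) (.pair (encodeList l) (encodeNat a))
        (.pair .nil (encodeNat (a + l.length))) T ∧ T ≤ l.length * 20 + 2 := by
    intro l
    induction l with
    | nil => exact fun a => ⟨_, .loopDone (.prim _ _), by omega⟩
    | cons b l ih =>
      intro a
      obtain ⟨T, hT, hTp⟩ := ih (a + 1)
      rw [show a + (b :: l).length = a + 1 + l.length by simp; omega]
      refine ⟨_, .loopStep (.prim _ _) (by simp [Prim.eval, encodeList]) (.pair (.seq (.prim _ _) (.prim _ _))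
        (.pair (.prim _ _) (.prim _ _))) hT, ?_⟩
      simp only [List.length_cons]
      omega
  obtain ⟨T, hT, hTp⟩ := key (l x) 0
  rw [zero_add] at hT
  refine ⟨T, hT, hTp.trans ?_⟩
  simp only [Polynomial.eval_add, Polynomial.eval_mul, Polynomial.eval_ofNat]
  gcongr
  exact hq x

theorem sum {n : X → ℕ} {r : ∀ x, Fin (n x) → ℝ}
    (hn : PT N e fun x => encodeNat (n x)) (hnN : PB N n)
    (hr : PT (fun y => N y.1) (withFin e n) fun y => .num (r y.1 y.2)) :
    PT N e fun x => .num (∑ i, r x i) := by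
  refine (foldr (S := fun _ => ℝ) (enc := fun _ => Val.num)
    (step := fun x i s => r x i + s) (init := fun _ => 0) hn hnN (zero N e)
    (add (X := Σ x, Fin (n x) × ℝ) (r := fun y => r y.1 y.2.1) (t := fun y => y.2.2)
      (withState (S := fun _ => ℝ) (enc := fun _ => Val.num) hr)
      (state (S := fun _ => ℝ) (enc := fun _ => Val.num)))).congr fun x => ?_
  rw [← List.sum_ofFn, List.ofFn_eq_map, List.sum, List.foldr_map]

/-- The length is the same for all inputs, so the entries can be computed by separate programs. This
is how the fixed graph `H` is written into a program. -/
theorem ofFn_const {n : ℕ} {v : Fin n → X → Val} (hv : ∀ i, PT N e (v i)) :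
    PT N e fun x => encodeList (List.ofFn fun i => v i x) := by
  induction n with
  | zero => exact (nil N e).congr fun x => by simp [encodeList]
  | succ n ih => simpa [List.ofFn_succ, encodeList] using (hv 0).pair (ih fun i => hv i.succ)

end PT

namespace PD

variable {X Y : Type*} {N : X → ℕ} {e : X → Val} {n : X → ℕ}

theorem exists_fin {b : ∀ x, Fin (n x) → Prop}
    (hn : PT N e fun x => encodeNat (n x)) (hnN : PB N n)
    (hb : PD (fun y => N y.1) (PT.withFin e n) fun y => b y.1 y.2) :
    PD N e fun x => ∃ i, b x i := by
  refine (PT.foldr (S := fun _ => Prop) (enc := fun _ => encodeProp)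
    (step := fun x i s => b x i ∨ s) (init := fun _ => False) hn hnN (const N e False)
    (or (X := Σ x, Fin (n x) × Prop) (a := fun y => b y.1 y.2.1) (b := fun y => y.2.2)
      (PT.withState (S := fun _ => Prop) (enc := fun _ => encodeProp) hb)
      (PT.state (S := fun _ => Prop) (enc := fun _ => encodeProp)))).congr fun x => congrArg _ (propext ?_)
  have key : ∀ l : List (Fin (n x)),
      l.foldr (fun i s => b x i ∨ s) False ↔ ∃ i ∈ l, b x i := by
    intro l
    induction l with
    | nil => simp
    | cons a l ih => simp [ih]
  simpa using key (List.finRange (n x))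

theorem forall_fin {b : ∀ x, Fin (n x) → Prop}
    (hn : PT N e fun x => encodeNat (n x)) (hnN : PB N n)
    (hb : PD (fun y => N y.1) (PT.withFin e n) fun y => b y.1 y.2) :
    PD N e fun x => ∀ i, b x i :=
  (exists_fin (b := fun x i => ¬ b x i) hn hnN hb.not).not.congr fun x => by simp

theorem nth {b : ∀ x, Fin (n x) → Prop} {i : ∀ x, Fin (n x)} (hnN : PB N n)
    (hb : PT N e fun x => encodeList (List.ofFn fun j => encodeProp (b x j)))
    (hi : PT N e fun x => encodeNat (i x)) : PD N e fun x => b x (i x) :=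
  PT.nth (v := fun x j => encodeProp (b x j)) hnN hb hi

/-- Take the predecessor of `j` exactly `i` times. The truncated difference is nonzero exactly when
`i < j`. -/
theorem nat_lt {i j : X → ℕ} (hb : PB N i) (hi : PT N e fun x => encodeNat (i x))
    (hj : PT N e fun x => encodeNat (j x)) : PD N e fun x => i x < j x := by
  refine (ne_nil (PT.foldr (S := fun _ => ℕ) (enc := fun _ => encodeNat)
    (step := fun _ _ s => s - 1) (init := j) hi hb hj
    (PT.encodeNat_pred (X := Σ x, Fin (i x) × ℕ) (i := fun y => y.2.2)
      (PT.state (S := fun _ => ℕ) (enc := fun _ => encodeNat))))).congr fun x => ?_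
  have key : ∀ (l : List (Fin (i x))) (a : ℕ), l.foldr (fun _ s => s - 1) a = a - l.length := by
    intro l a
    induction l with
    | nil => simp
    | cons b l ih => simp [ih]; omega
  rw [key, List.length_finRange, ← Nat.sub_pos_iff_lt]
  cases j x - i x <;> simp [encodeNat]

theorem fin_eq {i j : ∀ x, Fin (n x)} (hnN : PB N n)
    (hi : PT N e fun x => encodeNat (i x)) (hj : PT N e fun x => encodeNat (j x)) :
    PD N e fun x => i x = j x := by
  have hb : ∀ i : ∀ x, Fin (n x), PB N fun x => (i x : ℕ) :=
    fun i => hnN.imp fun p hp x => (i x).2.le.trans (hp x)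
  exact ((nat_lt (hb i) hi hj).not.and (nat_lt (hb j) hj hi).not).congr fun x => by
    rw [Fin.ext_iff]; omega

end PD

/-! ## Graph theory -/

universe u

namespace SimpleGraph

variable {V W : Type*} {G : SimpleGraph V}

/-- The graph with only those edges of `G` that have both ends in `C`. -/
def within (G : SimpleGraph V) (C : Set V) : SimpleGraph V where
  Adj u v := G.Adj u v ∧ u ∈ C ∧ v ∈ C
  symm := ⟨fun _ _ h => ⟨h.1.symm, h.2.2, h.2.1⟩⟩
  loopless := ⟨fun _ h => G.loopless.irrefl _ h.1⟩

theorem mem_of_embedding_within {C : Set V} {A : SimpleGraph W} (f : A ↪g G.within C) {a b : W}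
    (h : A.Adj a b) : f a ∈ C :=
  (f.map_adj_iff.2 h).2.1

/-- An embedding into `G.within C` of a graph without isolated vertices is one into `G`. -/
def embeddingOfWithin {C : Set V} {A : SimpleGraph W} (f : A ↪g G.within C)
    (hA : ∀ a, ∃ b, A.Adj a b) : A ↪g G where
  toFun := f
  inj' := f.injective
  map_rel_iff' := by
    intro a b
    obtain ⟨a', ha⟩ := hA a
    obtain ⟨b', hb⟩ := hA b
    rw [← f.map_adj_iff]
    exact ⟨fun h => ⟨h, mem_of_embedding_within f ha, mem_of_embedding_within f hb⟩, fun h => h.1⟩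

/-- `within` keeps the whole vertex set, so the vertices outside `C` become isolated. A copy of `A`
can use them only at isolated vertices of `A`, which the hypothesis excludes except when `A` has at
most one vertex. -/
theorem IsIndContained.of_within {C : Set V} {A : SimpleGraph W}
    (h : A.IsIndContained (G.within C)) (hA : Subsingleton W ∨ ∀ a, ∃ b, A.Adj a b) :
    A.IsIndContained G := by
  obtain ⟨f⟩ := h
  rcases hA with hA | hA
  · exact ⟨⟨⟨f, f.injective⟩, by
      intro a b
      simp [Subsingleton.elim a b]⟩⟩
  · exact ⟨embeddingOfWithin f hA⟩

/-- `p` followed by vertices of `K` forms an induced path with `m + 1` vertices. -/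
def IndPathFrom (G : SimpleGraph V) (m : ℕ) (p : V) (K : Set V) : Prop :=
  ∃ f : pathGraph (m + 1) ↪g G, f 0 = p ∧ ∀ i, i ≠ 0 → f i ∈ K

theorem indPathFrom_zero (p : V) (K : Set V) : G.IndPathFrom 0 p K :=
  ⟨⟨⟨fun _ => p, fun _ _ _ => Subsingleton.elim (α := Fin 1) _ _⟩, by
    intro a b
    simp [Subsingleton.elim (α := Fin 1) a b]⟩, rfl, fun i hi =>
      absurd (Subsingleton.elim (α := Fin 1) i 0) hi⟩

theorem IndPathFrom.cons {m : ℕ} {p q : V} {K K' : Set V} (h : G.IndPathFrom m q K')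
    (hpq : G.Adj p q) (hq : q ∈ K) (hK : K' ⊆ K) (hp : p ∉ K') (hpK : ∀ v ∈ K', ¬ G.Adj p v) :
    G.IndPathFrom (m + 1) p K := by
  obtain ⟨f, hf0, hf⟩ := h
  have hne : ∀ i, f i ≠ p := by
    intro i
    by_cases hi : i = 0
    · rw [hi, hf0]; exact hpq.ne'
    · exact fun h => hp (h ▸ hf i hi)
  have hadj : ∀ i, G.Adj p (f i) ↔ i = 0 := by
    intro i
    by_cases hi : i = 0
    · simp [hi, hf0, hpq]
    · simp [hi, hpK _ (hf i hi)]
  refine ⟨⟨⟨Fin.cons (α := fun _ => V) p f, ?_⟩, ?_⟩, rfl, ?_⟩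
  · rw [Fin.cons_injective_iff]
    exact ⟨by rintro ⟨i, hi⟩; exact hne i hi, f.injective⟩
  · intro a b
    refine Fin.cases ?_ (fun a => ?_) a <;> refine Fin.cases ?_ (fun b => ?_) b
    · simp
    · simp only [Function.Embedding.coeFn_mk, Fin.cons_zero, Fin.cons_succ, hadj, pathGraph_adj,
        Fin.val_zero, Fin.val_succ, Fin.ext_iff]
      omega
    · simp only [Function.Embedding.coeFn_mk, Fin.cons_zero, Fin.cons_succ, G.adj_comm _ p, hadj,
        pathGraph_adj, Fin.val_zero, Fin.val_succ, Fin.ext_iff]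
      omega
    · simp only [Function.Embedding.coeFn_mk, Fin.cons_succ, f.map_adj_iff, pathGraph_adj,
        Fin.val_succ]
      omega
  · intro i hi
    obtain ⟨j, rfl⟩ := Fin.exists_succ_eq.2 hi
    by_cases hj : j = 0
    · simpa [hj, hf0] using hq
    · simpa using hK (hf j hj)

/-- The vertex set of the component of `u` in the subgraph induced by `C`. -/
def reach (G : SimpleGraph V) (C : Set V) (u : V) : Set V :=
  {v | (G.within C).Reachable u v}

/-- The trivial walk puts `u` into its own `reach` even when `u ∉ C`, hence the assumption `hu`. -/
theorem mem_of_mem_reach {C : Set V} {u v : V} (hu : u ∈ C) (h : v ∈ G.reach C u) : v ∈ C := by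
  obtain ⟨w⟩ := Reachable.symm h
  cases w with
  | nil => exact hu
  | cons h _ => exact h.2.1

theorem reach_mono {C C' : Set V} (h : C ⊆ C') (u : V) : G.reach C u ⊆ G.reach C' u :=
  fun _ hv => Reachable.mono
    (show G.within C ≤ G.within C' from fun _ _ hab => ⟨hab.1, h hab.2.1, h hab.2.2⟩) hv

/-- `C` can be exhausted in `j` rounds; a round passes to a component and removes a closed
neighbourhood from it. -/
def Peelable (G : SimpleGraph V) : ℕ → Set V → Prop
  | 0, C => C = ∅
  | j + 1, C => ∀ u ∈ C, ∃ p, G.Peelable j {v ∈ G.reach C u | v ≠ p ∧ ¬ G.Adj p v}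

theorem Peelable.mono {j : ℕ} {C C' : Set V} (h : G.Peelable j C') (hC : C ⊆ C') :
    G.Peelable j C := by
  induction j generalizing C C' with
  | zero => exact Set.subset_eq_empty hC h
  | succ j ih =>
    intro u hu
    obtain ⟨p, hp⟩ := h u (hC hu)
    exact ⟨p, ih hp fun v hv => ⟨reach_mono hC u hv.1, hv.2⟩⟩

/-- Gyárfás' path argument. Delete the closed neighbourhood of `p` from its component `K`. Each
component `K'` of the rest has a neighbour `p'` in `K` that is adjacent to `p`. An induced path from
`p'` into `K'` extends by `p`, since `p` has no neighbours in `K'`; so the longest such path shrinks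
by one vertex per round. For `m = 0` the one-vertex path always exists, so `C` must be empty. -/
theorem peelable_of_forall {m : ℕ} {C : Set V}
    (h : ∀ u ∈ C, ∃ p, ¬ G.IndPathFrom m p (G.reach C u) ∧
      ∃ q ∈ G.reach C u, q = p ∨ G.Adj p q) : G.Peelable m C := by
  induction m generalizing C with
  | zero =>
    refine Set.eq_empty_iff_forall_notMem.2 fun u hu => ?_
    obtain ⟨p, hp, -⟩ := h u hu
    exact hp (indPathFrom_zero _ _)
  | succ m ih =>
    intro u hu
    obtain ⟨p, hp, w, hw, hpw⟩ := h u hu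
    refine ⟨p, ih fun u' hu' => ?_⟩
    set K := G.reach C u
    set C' := {v ∈ K | v ≠ p ∧ ¬ G.Adj p v}
    have hK' : G.reach C' u' ⊆ C' := fun v hv => mem_of_mem_reach hu' hv
    have hwK' : w ∉ G.reach C' u' := fun h => by
      rcases hpw with rfl | hpw
      · exact (hK' h).2.1 rfl
      · exact (hK' h).2.2 hpw
    obtain ⟨walk⟩ : (G.within C).Reachable u' w := (Reachable.symm hu'.1).trans hw
    -- A walk inside `C` from `K'` to `w`, which was deleted or lies outside the rest, has an edge
    -- `d` leaving `K'`. Its outer end lies in `K` but not in the rest `C'`, so it is in the closed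
    -- neighbourhood of `p`; it is not `p` because its inner end is not adjacent to `p`.
    obtain ⟨d, -, hd1, hd2⟩ := walk.exists_boundary_dart (G.reach C' u')
      (Reachable.refl u') hwK'
    have hdK : d.snd ∈ K := Reachable.trans (hK' hd1).1 d.adj.reachable
    have hdC : d.snd ∉ C' := fun hmem =>
      hd2 (Reachable.trans hd1 (Adj.reachable ⟨d.adj.1, hK' hd1, hmem⟩))
    have hne : d.snd ≠ p := by
      intro hdp
      exact (hK' hd1).2.2 (hdp ▸ d.adj.1.symm)
    have hadj : G.Adj p d.snd := by
      by_contra hn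
      exact hdC ⟨hdK, hne, hn⟩
    refine ⟨d.snd, fun hpath => hp ?_, d.fst, hd1, Or.inr d.adj.1.symm⟩
    exact hpath.cons hadj hdK (fun v hv => (hK' hv).1) (fun h => (hK' h).2.1 rfl)
      fun v hv => (hK' hv).2.2

theorem peelable_of_pathGraph_free {m : ℕ} (h : ¬ (pathGraph (m + 1)).IsIndContained G)
    (C : Set V) : G.Peelable m C :=
  peelable_of_forall fun u _ => ⟨u, fun ⟨f, _⟩ => h ⟨f⟩, u, Reachable.refl u, Or.inl rfl⟩

/-- Ramsey's theorem for graphs. -/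
theorem exists_ramsey (s t : ℕ) : ∃ R : ℕ, ∀ {V : Type u} (G : SimpleGraph V) (S : Finset V),
    R ≤ S.card → (∃ f : Fin s ↪ V, (∀ i, f i ∈ S) ∧ ∀ i j, i ≠ j → G.Adj (f i) (f j)) ∨
      ∃ f : Fin t ↪ V, (∀ i, f i ∈ S) ∧ ∀ i j, ¬ G.Adj (f i) (f j) := by
  classical
  suffices h : ∀ n s t, s + t ≤ n → ∃ R : ℕ, ∀ {V : Type u} (G : SimpleGraph V) (S : Finset V),
      R ≤ S.card → (∃ T ⊆ S, T.card = s ∧ ∀ a ∈ T, ∀ b ∈ T, a ≠ b → G.Adj a b) ∨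
        ∃ T ⊆ S, T.card = t ∧ ∀ a ∈ T, ∀ b ∈ T, ¬ G.Adj a b by
    obtain ⟨R, hR⟩ := h _ s t le_rfl
    refine ⟨R, fun G S hS => (hR G S hS).imp ?_ ?_⟩
    · rintro ⟨T, hTS, hT, hG⟩
      let f := (T.equivFin.symm.toEmbedding.trans (Function.Embedding.subtype _))
      subst hT
      exact ⟨f, fun i => hTS (T.equivFin.symm i).2, fun i j hij =>
        hG _ (T.equivFin.symm i).2 _ (T.equivFin.symm j).2 (f.injective.ne hij)⟩
    · rintro ⟨T, hTS, hT, hG⟩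
      let f := (T.equivFin.symm.toEmbedding.trans (Function.Embedding.subtype _))
      subst hT
      exact ⟨f, fun i => hTS (T.equivFin.symm i).2, fun i j =>
        hG _ (T.equivFin.symm i).2 _ (T.equivFin.symm j).2⟩
  intro n
  induction n with
  | zero =>
    intro s t hst
    refine ⟨0, fun G S _ => Or.inl ⟨∅, by simp, ?_, by simp⟩⟩
    simp; omega
  | succ n ih =>
    intro s t hst
    rcases s with _ | s
    · exact ⟨0, fun G S _ => Or.inl ⟨∅, by simp, by simp, by simp⟩⟩
    rcases t with _ | t
    · exact ⟨0, fun G S _ => Or.inr ⟨∅, by simp, by simp, by simp⟩⟩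
    obtain ⟨R₁, h₁⟩ := ih s (t + 1) (by omega)
    obtain ⟨R₂, h₂⟩ := ih (s + 1) t (by omega)
    -- Apart from `v` there remain `R₁ + R₂` vertices, so `v` has `R₁` neighbours or `R₂`
    -- non-neighbours among them.
    refine ⟨R₁ + R₂ + 1, fun {V} G S hS => ?_⟩
    obtain ⟨v, hv⟩ : S.Nonempty := Finset.card_pos.1 (by omega)
    have hcard := Finset.card_filter_add_card_filter_not (s := S.erase v) (fun w => G.Adj v w)
    rw [Finset.card_erase_of_mem hv] at hcard
    have hsub : ∀ q : V → Prop, [DecidablePred q] → (S.erase v).filter q ⊆ S := fun q _ =>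
      (Finset.filter_subset _ _).trans (Finset.erase_subset _ _)
    rcases le_or_gt R₁ ((S.erase v).filter (fun w => G.Adj v w)).card with h | h
    · refine (h₁ G _ h).imp ?_ ?_
      · rintro ⟨T, hTS, hT, hG⟩
        have hvT : ∀ w ∈ T, G.Adj v w := fun w hw => (Finset.mem_filter.1 (hTS hw)).2
        refine ⟨insert v T, Finset.insert_subset hv (hTS.trans (hsub _)), ?_, ?_⟩
        · rw [Finset.card_insert_of_notMem fun h => G.loopless.irrefl _ (hvT v h), hT]
        · intro a ha b hb hab
          rcases Finset.mem_insert.1 ha with rfl | ha' <;>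
            rcases Finset.mem_insert.1 hb with rfl | hb'
          · exact absurd rfl hab
          · exact hvT b hb'
          · exact (hvT a ha').symm
          · exact hG a ha' b hb' hab
      · rintro ⟨T, hTS, hT, hG⟩
        exact ⟨T, hTS.trans (hsub _), hT, hG⟩
    · refine (h₂ G ((S.erase v).filter (fun w => ¬ G.Adj v w)) (by omega)).imp ?_ ?_
      · rintro ⟨T, hTS, hT, hG⟩
        exact ⟨T, hTS.trans (hsub _), hT, hG⟩
      · rintro ⟨T, hTS, hT, hG⟩
        have hvT : ∀ w ∈ T, w ≠ v ∧ ¬ G.Adj v w := fun w hw =>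
          ⟨Finset.ne_of_mem_erase (Finset.mem_filter.1 (hTS hw)).1, (Finset.mem_filter.1 (hTS hw)).2⟩
        refine ⟨insert v T, Finset.insert_subset hv (hTS.trans (hsub _)), ?_, ?_⟩
        · rw [Finset.card_insert_of_notMem fun h => (hvT v h).1 rfl, hT]
        · intro a ha b hb
          rcases Finset.mem_insert.1 ha with rfl | ha' <;>
            rcases Finset.mem_insert.1 hb with rfl | hb'
          · exact G.loopless.irrefl _
          · exact (hvT b hb').2
          · exact fun h => (hvT a ha').2 h.symm
          · exact hG a ha' b hb'

end SimpleGraph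

/-! ### Consequences of excluding `L_s`, `S_t` and the antenna. -/

open SimpleGraph

/-- Leaving the edges among the leaves `l i` open in `A` makes one argument serve both `S_t` and
`L_s`. -/
theorem subdividedStar_embedding {V : Type*} {G : SimpleGraph V} {t : ℕ} {q : V}
    {d l : Fin t → V} (hqd : ∀ i, G.Adj q (d i)) (hql : ∀ i, l i ≠ q ∧ ¬ G.Adj q (l i))
    (hd : ∀ i j, ¬ G.Adj (d i) (d j)) (hdl : ∀ i j, G.Adj (d i) (l j) ↔ i = j)
    {A : SimpleGraph (Option (Fin t × Bool))}
    (hA : ∀ a b, A.Adj a b ↔ (subdividedStar t).Adj a b ∨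
      ∃ i j, a = some (i, true) ∧ b = some (j, true) ∧ G.Adj (l i) (l j)) :
    A.IsIndContained G := by
  let f : Option (Fin t × Bool) → V := fun a => a.elim q fun x => if x.2 then l x.1 else d x.1
  have hf : ∀ a b, G.Adj (f a) (f b) ↔ A.Adj a b := by
    intro a b
    rw [hA]
    rcases a with _ | ⟨i, _ | _⟩ <;> rcases b with _ | ⟨j, _ | _⟩ <;>
      simp [f, subdividedStar, hqd, hql, hd, hdl, (hqd _).symm, fun i => G.adj_comm (l i) q,
        fun i j => G.adj_comm (l i) (d j)]
    exact eq_comm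
  have hinj : Function.Injective f := by
    intro a b hab
    have hdne : ∀ i, d i ≠ q := fun i => (hqd i).ne'
    have hdd : ∀ i j, d i = d j → i = j := fun i j h => by
      rw [← hdl i j, h, hdl]
    have hll : ∀ i j, l i = l j → i = j := fun i j h => by
      rw [← hdl i j, ← h, hdl]
    have hdl' : ∀ i j, d i ≠ l j := fun i j h => (hql j).2 (h ▸ hqd i)
    rcases a with _ | ⟨i, _ | _⟩ <;> rcases b with _ | ⟨j, _ | _⟩ <;> simp [f] at hab ⊢
    · exact hdne _ hab.symm
    · exact (hql j).1 hab.symm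
    · exact hdne _ hab
    · exact hdd _ _ hab
    · exact hdl' _ _ hab
    · exact (hql i).1 hab
    · exact hdl' _ _ hab.symm
    · exact hll _ _ hab
  exact ⟨⟨⟨f, hinj⟩, hf _ _⟩⟩

/-- In a graph without induced `L_s` and `S_t`, the neighbours, outside the neighbourhood of `q`, of
an independent set `S` of neighbours of `q` are dominated by boundedly many vertices of `S`. -/
theorem exists_small_dominating (s t : ℕ) : ∃ R : ℕ, ∀ {V : Type u} (G : SimpleGraph V),
    ¬ (leafCliqueStar s).IsIndContained G → ¬ (subdividedStar t).IsIndContained G →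
    ∀ (q : V) (S : Finset V) (B : Set V), (∀ v ∈ S, v = q ∨ G.Adj q v) →
      (∀ u ∈ S, ∀ v ∈ S, ¬ G.Adj u v) → (∀ u ∈ B, ¬ G.Adj q u) →
      ∃ D ⊆ S, D.card ≤ R ∧ ∀ v ∈ S, ∀ u ∈ B, G.Adj v u → ∃ d ∈ D, G.Adj d u := by
  classical
  obtain ⟨R, hR⟩ := exists_ramsey.{u} s t
  -- A set `D` with more than `R + 2` elements is large enough for Ramsey's theorem and has two
  -- elements, which is needed to tell private neighbours from `q`.
  refine ⟨R + 2, fun {V} G hL hS q S B hSq hSS hB => ?_⟩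
  have hne : (S.powerset.filter fun D => ∀ v ∈ S, ∀ u ∈ B, G.Adj v u → ∃ d ∈ D, G.Adj d u).Nonempty :=
    ⟨S, by simp only [Finset.mem_filter, Finset.mem_powerset, subset_rfl, true_and]
           exact fun v hv u _ h => ⟨v, hv, h⟩⟩
  obtain ⟨D, hD, hmin⟩ := Finset.exists_min_image _ Finset.card hne
  rw [Finset.mem_filter, Finset.mem_powerset] at hD
  refine ⟨D, hD.1, ?_, hD.2⟩
  by_contra hcard
  -- If `d` had no private neighbour, `D.erase d` would still dominate, against the minimality of
  -- `D`.
  have hpriv : ∀ d ∈ D, ∃ u ∈ B, ∀ d' ∈ D, G.Adj d' u ↔ d' = d := by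
    intro d hd
    by_contra! hno
    have hmem : D.erase d ∈ S.powerset.filter
        fun D => ∀ v ∈ S, ∀ u ∈ B, G.Adj v u → ∃ d ∈ D, G.Adj d u := by
      rw [Finset.mem_filter, Finset.mem_powerset]
      refine ⟨(Finset.erase_subset _ _).trans hD.1, fun v hv u hu hvu => ?_⟩
      obtain ⟨d', hd', hdu⟩ := hD.2 v hv u hu hvu
      by_cases hdd : d' = d
      · subst hdd
        obtain ⟨d'', hd'', h⟩ := hno u hu
        rcases h with h | h
        · exact ⟨d'', Finset.mem_erase.2 ⟨h.2, hd''⟩, h.1⟩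
        · exact absurd (h.2 ▸ hdu) h.1
      · exact ⟨d', Finset.mem_erase.2 ⟨hdd, hd'⟩, hdu⟩
    have := hmin _ hmem
    rw [Finset.card_erase_of_mem hd] at this
    have := Finset.card_pos.2 ⟨d, hd⟩
    omega
  choose! l hlB hl using hpriv
  -- `S` may contain `q`, but `D` does not: its members have private neighbours in `B`, where
  -- nothing is adjacent to `q`.
  have hqD : ∀ d ∈ D, G.Adj q d := by
    intro d hd
    rcases hSq d (hD.1 hd) with rfl | h
    · exact absurd ((hl d hd d hd).2 rfl) (hB _ (hlB d hd))
    · exact h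
  have hlq : ∀ d ∈ D, l d ≠ q := by
    intro d hd hlq
    obtain ⟨d', hd', hne⟩ := Finset.exists_mem_ne (by omega : 1 < D.card) d
    exact hne ((hl d hd d' hd').1 (hlq ▸ (hqD d' hd').symm))
  -- Ramsey's theorem is applied to the private neighbours, indexed by `D`: a clique gives `L_s`, an
  -- independent set gives `S_t`.
  rcases hR (G.comap l) D (by omega) with ⟨f, hf, hadj⟩ | ⟨f, hf, hadj⟩
  · refine hL (subdividedStar_embedding (d := f) (l := fun i => l (f i)) (fun i => hqD _ (hf i))
      (fun i => ⟨hlq _ (hf i), hB _ (hlB _ (hf i))⟩)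
      (fun i j => hSS _ (hD.1 (hf i)) _ (hD.1 (hf j)))
      (fun i j => by rw [hl _ (hf j) _ (hf i), f.injective.eq_iff]) ?_)
    intro a b
    have key : ∀ i j, G.Adj (l (f i)) (l (f j)) ↔ i ≠ j := fun i j =>
      ⟨fun h hij => G.loopless.irrefl _ (hij ▸ h), hadj i j⟩
    simp only [leafCliqueStar, sup_adj, fromRel_adj, key]
    refine or_congr_right ⟨?_, ?_⟩
    · rintro ⟨hab, ⟨i, j, rfl, rfl⟩ | ⟨j, i, rfl, rfl⟩⟩
      · exact ⟨i, j, rfl, rfl, fun h => hab (by rw [h])⟩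
      · exact ⟨i, j, rfl, rfl, fun h => hab (by rw [h])⟩
    · rintro ⟨i, j, rfl, rfl, hij⟩
      exact ⟨by simpa using hij, Or.inl ⟨i, j, rfl, rfl⟩⟩
  · refine hS (subdividedStar_embedding (d := f) (l := fun i => l (f i)) (fun i => hqD _ (hf i))
      (fun i => ⟨hlq _ (hf i), hB _ (hlB _ (hf i))⟩)
      (fun i j => hSS _ (hD.1 (hf i)) _ (hD.1 (hf j)))
      (fun i j => by rw [hl _ (hf j) _ (hf i), f.injective.eq_iff]) ?_)
    intro a b
    refine ⟨Or.inl, ?_⟩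
    rintro (h | ⟨i, j, -, -, h⟩)
    · exact h
    · exact absurd h (hadj i j)

theorem exists_adj_subdividedStar {s : ℕ} (hs : s ≠ 0) (a : Option (Fin s × Bool)) :
    ∃ b, (subdividedStar s).Adj a b := by
  rcases a with _ | ⟨i, _ | _⟩
  · exact ⟨some (⟨0, by omega⟩, false), rfl⟩
  · exact ⟨none, rfl⟩
  · exact ⟨some (i, false), rfl, by simp⟩

theorem map_some_adj_some {V : Type*} {A : SimpleGraph V} {a b : V} :
    (A.map Function.Embedding.some).Adj (some a) (some b) ↔ A.Adj a b :=
  map_adj_apply (f := Function.Embedding.some)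

theorem not_map_some_none_adj {V : Type*} {A : SimpleGraph V} {a : Option V} :
    ¬ (A.map Function.Embedding.some).Adj none a := by
  rintro ⟨-, u, v, -, h, -⟩
  exact absurd h (by simp)

theorem not_map_some_adj_none {V : Type*} {A : SimpleGraph V} {a : Option V} :
    ¬ (A.map Function.Embedding.some).Adj a none :=
  fun h => not_map_some_none_adj h.symm

/-- In an `antenna F`-free graph, a set in the closed neighbourhood of `p` that has no neighbours
of some `q` in that closed neighbourhood induces an `F`-free graph. -/
theorem forbidFree_within {s t : ℕ} {VF V : Type*} [Nontrivial VF] {F : SimpleGraph VF}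
    (hF : F.Connected) {G : SimpleGraph V} (hG : ForbidFree s t (antenna F) G) {C : Set V} {p q : V}
    (hC : ∀ v ∈ C, (v = p ∨ G.Adj p v) ∧ ¬ G.Adj q v ∧ (q = p ∨ G.Adj p q)) :
    ForbidFree s t F (G.within C) := by
  have hsub : ∀ s : ℕ, s = 0 → Subsingleton (Option (Fin s × Bool)) := by
    rintro _ rfl; infer_instance
  refine ⟨fun h => hG.1 (h.of_within (Or.inr ?_)), fun h => hG.2.1 (h.of_within ?_),
    fun h => hG.2.2.1 (h.of_within ?_), ?_⟩
  · exact fun a => (pathGraph_connected 5).preconnected.exists_adj_of_nontrivial a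
  · by_cases hs : s = 0
    · exact Or.inl (hsub s hs)
    · exact Or.inr fun a => (exists_adj_subdividedStar hs a).imp fun b h => Or.inl h
  · by_cases ht : t = 0
    · exact Or.inl (hsub t ht)
    · exact Or.inr (exists_adj_subdividedStar ht)
  · rintro ⟨f⟩
    have hnb := fun a => hF.preconnected.exists_adj_of_nontrivial a
    have hfC : ∀ a, f a ∈ C := fun a => mem_of_embedding_within f (hnb a).choose_spec
    let f' := embeddingOfWithin f hnb
    have hq : ∀ a, f a ≠ q := by
      intro a ha
      obtain ⟨b, hb⟩ := hnb a
      exact (hC _ (hfC b)).2.1 (ha ▸ f'.map_adj_iff.2 hb)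
    obtain ⟨a₀⟩ := hF.nonempty
    have hpq : G.Adj p q := by
      -- If `q = p`, then `C` consists of at most `p` itself, while the copy of `F` avoids `q`.
      rcases (hC _ (hfC a₀)).2.2 with rfl | h
      · rcases (hC _ (hfC a₀)).1 with h | h
        · exact absurd h (hq a₀)
        · exact absurd h (hC _ (hfC a₀)).2.1
      · exact h
    have hfp : ∀ a, G.Adj p (f a) := by
      intro a
      rcases (hC _ (hfC a)).1 with h | h
      · exact absurd hpq.symm (h ▸ (hC _ (hfC a)).2.1)
      · exact h
    have hfq : ∀ a, ¬ G.Adj q (f a) := fun a => (hC _ (hfC a)).2.1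
    let g : Option (Option VF) → V := fun a => a.elim p fun a => a.elim q f
    have hg : ∀ a b, G.Adj (g a) (g b) ↔ (antenna F).Adj a b := by
      have hadj : ∀ a b, G.Adj (f a) (f b) ↔ F.Adj a b := fun a b => f'.map_adj_iff
      rintro (_ | _ | a) (_ | _ | b) <;>
        simp only [antenna, addUniversal, addIsolated, sup_adj, fromRel_adj, map_some_adj_some,
          not_map_some_adj_none, not_map_some_none_adj] <;>
        simp [g, hpq, hpq.symm, hfp, (hfp _).symm, hfq, fun a => G.adj_comm (f a) q, hadj]
    refine hG.2.2.2 ⟨⟨⟨g, ?_⟩, hg _ _⟩⟩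
    rintro (_ | _ | a) (_ | _ | b) <;>
      simp [g, hpq.ne, hpq.ne', (hfp _).ne, hq, Ne.symm (hq _), (hfp _).ne']

/-! ## Instances and safe colorings -/

/-- An instance of Max Partial `H`-Coloring with a graph from the class `𝒞`. -/
structure Inst (k : ℕ) (𝒞 : ∀ n : ℕ, SimpleGraph (Fin n) → Prop) where
  n : ℕ
  G : SimpleGraph (Fin n)
  rev : Fin n → Fin k → ℝ
  mem : 𝒞 n G

section Combine

variable {V W : Type*}

open Classical in
/-- The coloring `φ` on `A` and `ψ` elsewhere. -/
noncomputable def combine (A : Set V) (φ ψ : V → Option W) : V → Option W :=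
  fun v => if v ∈ A then φ v else ψ v

theorem combine_of_mem {A : Set V} {φ ψ : V → Option W} {v : V} (h : v ∈ A) :
    combine A φ ψ v = φ v := if_pos h

theorem combine_of_notMem {A : Set V} {φ ψ : V → Option W} {v : V} (h : v ∉ A) :
    combine A φ ψ v = ψ v := if_neg h

theorem combine_none_eq_some {A : Set V} {φ : V → Option W} {v : V} {c : W} :
    combine A φ (fun _ => none) v = some c ↔ v ∈ A ∧ φ v = some c := by
  by_cases h : v ∈ A <;> simp [combine, h]

theorem revenue_combine [Fintype V] (rev : V → W → ℝ) (A : Set V) (φ ψ : V → Option W) :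
    revenue rev (combine A φ ψ) =
      revenue rev (combine A φ fun _ => none) + revenue rev (combine Aᶜ ψ fun _ => none) := by
  simp only [revenue, ← Finset.sum_add_distrib]
  refine Finset.sum_congr rfl fun v _ => ?_
  by_cases h : v ∈ A <;> simp [combine, h]

end Combine

theorem IsPartialColoring.of_le {V W : Type*} {G : SimpleGraph V} {H : SimpleGraph W}
    {φ ψ : V → Option W} (hφ : IsPartialColoring G H φ)
    (h : ∀ v c, ψ v = some c → φ v = some c) : IsPartialColoring G H ψ :=
  fun u v a b hu hv => hφ u v a b (h u a hu) (h v b hv)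

namespace Inst

variable {k : ℕ} {𝒞 : ∀ n : ℕ, SimpleGraph (Fin n) → Prop} (H : SimpleGraph (Fin k))
  (I : Inst k 𝒞)

/-- Partial colorings of the vertices of an instance. -/
abbrev Coloring := Fin I.n → Option (Fin k)

/-- A partial coloring that uses no assignment of negative revenue. -/
def Safe (φ : I.Coloring) : Prop :=
  IsPartialColoring I.G H φ ∧ ∀ v c, φ v = some c → 0 ≤ I.rev v c

/-- A safe coloring of maximum revenue. -/
def Opt (φ : I.Coloring) : Prop :=
  I.Safe H φ ∧ ∀ ψ, I.Safe H ψ → revenue I.rev ψ ≤ revenue I.rev φ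

/-- The vertices that a safe coloring may color. -/
def active : Set (Fin I.n) := {v | ∃ c, 0 ≤ I.rev v c}

open Classical in
/-- The colors that a safe coloring may use. -/
noncomputable def live : Finset (Fin k) := Finset.univ.filter fun c => ∃ v, 0 ≤ I.rev v c

open Classical in
/-- Forbid all assignments outside `M`. -/
noncomputable def mask (M : Fin I.n → Fin k → Prop) : Inst k 𝒞 where
  n := I.n
  G := I.G
  rev v c := if M v c then I.rev v c else -1
  mem := I.mem

variable {H I}

theorem mask_rev_nonneg {M : Fin I.n → Fin k → Prop} {v : Fin I.n} {c : Fin k} :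
    0 ≤ (I.mask M).rev v c ↔ M v c ∧ 0 ≤ I.rev v c := by
  by_cases h : M v c <;> simp [mask, h]

theorem safe_mask {M : Fin I.n → Fin k → Prop} {φ : I.Coloring} :
    (I.mask M).Safe H φ ↔ I.Safe H φ ∧ ∀ v c, φ v = some c → M v c := by
  constructor
  · exact fun h => ⟨⟨h.1, fun v c hv => (mask_rev_nonneg.1 (h.2 v c hv)).2⟩,
      fun v c hv => (mask_rev_nonneg.1 (h.2 v c hv)).1⟩
  · exact fun h => ⟨h.1.1, fun v c hv => mask_rev_nonneg.2 ⟨h.2 v c hv, h.1.2 v c hv⟩⟩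

theorem revenue_mask {M : Fin I.n → Fin k → Prop} {φ : I.Coloring}
    (h : ∀ v c, φ v = some c → M v c) : revenue (I.mask M).rev φ = revenue I.rev φ := by
  refine Finset.sum_congr rfl fun v _ => ?_
  cases hv : φ v with
  | none => rfl
  | some c => simp [mask, h v c hv]

/-- A mask leaves the revenue of the colorings obeying it unchanged, so the comparison can be made
in the original revenues. -/
theorem opt_mask {M : Fin I.n → Fin k → Prop} {φ : I.Coloring} (hφ : (I.mask M).Opt H φ)
    {ψ : I.Coloring} (hψ : I.Safe H ψ) (hM : ∀ v c, ψ v = some c → M v c) :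
    revenue I.rev ψ ≤ revenue I.rev φ := by
  rw [← revenue_mask hM, ← revenue_mask (safe_mask.1 hφ.1).2]
  exact hφ.2 ψ (safe_mask.2 ⟨hψ, hM⟩)

theorem active_mask {M : Fin I.n → Fin k → Prop} {v : Fin I.n} :
    v ∈ (I.mask M).active ↔ ∃ c, M v c ∧ 0 ≤ I.rev v c := by
  exact exists_congr fun c => mask_rev_nonneg

theorem live_mask {M : Fin I.n → Fin k → Prop} {c : Fin k} :
    c ∈ (I.mask M).live ↔ ∃ v, M v c ∧ 0 ≤ I.rev v c := by
  simp only [live, Finset.mem_filter, Finset.mem_univ, true_and]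
  exact exists_congr fun v => mask_rev_nonneg

theorem live_mask_subset (M : Fin I.n → Fin k → Prop) : (I.mask M).live ⊆ I.live := by
  intro c hc
  obtain ⟨v, -, hv⟩ := live_mask.1 hc
  simpa [live] using ⟨v, hv⟩

theorem Safe.of_le {φ ψ : I.Coloring} (hφ : I.Safe H φ)
    (h : ∀ v c, ψ v = some c → φ v = some c) : I.Safe H ψ :=
  ⟨hφ.1.of_le h, fun v c hv => hφ.2 v c (h v c hv)⟩

theorem safe_none : I.Safe H fun _ => none := ⟨by simp [IsPartialColoring], by simp⟩

theorem Safe.mem_active {φ : I.Coloring} (h : I.Safe H φ) {v : Fin I.n} {c : Fin k}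
    (hv : φ v = some c) : v ∈ I.active := ⟨c, h.2 v c hv⟩

theorem exists_opt (H : SimpleGraph (Fin k)) (I : Inst k 𝒞) : ∃ φ, I.Opt H φ := by
  classical
  obtain ⟨φ, hφ, h⟩ := Finset.exists_max_image
    (Finset.univ.filter fun φ : I.Coloring => I.Safe H φ) (revenue I.rev)
    ⟨fun _ => none, by simpa using safe_none⟩
  exact ⟨φ, (Finset.mem_filter.1 hφ).2, fun ψ hψ => h ψ (by simpa using hψ)⟩

theorem opt_of_revenue_le {φ ψ : I.Coloring} (hφ : I.Opt H φ) (hψ : I.Safe H ψ)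
    (h : revenue I.rev φ ≤ revenue I.rev ψ) : I.Opt H ψ :=
  ⟨hψ, fun χ hχ => (hφ.2 χ hχ).trans h⟩

theorem Safe.eq_none {φ : I.Coloring} (h : I.Safe H φ) (hI : I.active = ∅) :
    φ = fun _ => none := by
  funext v
  cases hv : φ v with
  | none => rfl
  | some c => exact absurd (h.mem_active hv) (by simp [hI])

theorem opt_of_active_eq_empty (hI : I.active = ∅) {φ : I.Coloring} (h : I.Safe H φ) :
    I.Opt H φ :=
  ⟨h, fun ψ hψ => by rw [h.eq_none hI, hψ.eq_none hI]⟩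

open Classical in
/-- Dropping the assignments of negative revenue. -/
noncomputable def dropNeg (I : Inst k 𝒞) (φ : I.Coloring) : I.Coloring :=
  fun v => (φ v).filter fun c => 0 ≤ I.rev v c

theorem dropNeg_eq_some {φ : I.Coloring} {v : Fin I.n} {c : Fin k} :
    I.dropNeg φ v = some c ↔ φ v = some c ∧ 0 ≤ I.rev v c := by
  simp [dropNeg, Option.filter_eq_some_iff]

theorem safe_dropNeg {φ : I.Coloring} (h : IsPartialColoring I.G H φ) :
    I.Safe H (I.dropNeg φ) :=
  ⟨h.of_le fun _ _ hv => (dropNeg_eq_some.1 hv).1, fun _ _ hv => (dropNeg_eq_some.1 hv).2⟩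

theorem elim_le_dropNeg (φ : I.Coloring) (v : Fin I.n) :
    (φ v).elim 0 (I.rev v) ≤ (I.dropNeg φ v).elim 0 (I.rev v) := by
  cases hv : φ v with
  | none => simp [dropNeg, hv]
  | some c =>
    by_cases hc : 0 ≤ I.rev v c
    · simp [dropNeg, hv, Option.filter, hc]
    · simpa [dropNeg, hv, Option.filter, hc] using (not_le.1 hc).le

theorem Opt.isOptimumSolution {φ : I.Coloring} (h : I.Opt H φ) :
    IsOptimumSolution I.G H I.rev φ :=
  ⟨h.1.1, fun ψ hψ => (Finset.sum_le_sum fun v _ => elim_le_dropNeg ψ v).trans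
    (h.2 _ (safe_dropNeg hψ))⟩

/-- Only the edges between active vertices matter. -/
theorem opt_of_isOptimumSolution {φ : I.Coloring}
    (h : IsOptimumSolution (I.G.within I.active) H I.rev φ) : I.Opt H φ := by
  have hdrop : IsPartialColoring (I.G.within I.active) H (I.dropNeg φ) :=
    h.1.of_le fun _ _ hv => (dropNeg_eq_some.1 hv).1
  -- Dropping an assignment of negative revenue would strictly raise the total, so an optimum has
  -- none.
  have hnn : ∀ v c, φ v = some c → 0 ≤ I.rev v c := by
    intro v c hv
    by_contra hc
    refine absurd (h.2 _ hdrop) (not_le.2 (Finset.sum_lt_sum (fun v _ => elim_le_dropNeg φ v)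
      ⟨v, Finset.mem_univ v, ?_⟩))
    have : I.dropNeg φ v = none := by simp [dropNeg, hv, Option.filter, hc]
    rw [this, hv]
    exact not_le.1 hc
  refine ⟨⟨fun u v a b hu hv huv => h.1 u v a b hu hv ⟨huv, ⟨a, hnn u a hu⟩, ⟨b, hnn v b hv⟩⟩, hnn⟩,
    fun ψ hψ => h.2 ψ fun u v a b hu hv huv => hψ.1 u v a b hu hv huv.1⟩

/-! ### Decoupling -/

/-- The assignments `(v, c)` with `v` in `A` such that `Z` announces color `c` to all active
neighbours of `v` outside `A`. -/
def innerMask (I : Inst k 𝒞) (A : Set (Fin I.n)) (Z : Fin I.n → Fin k → Prop) :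
    Fin I.n → Fin k → Prop :=
  fun v c => v ∈ A ∧ ∀ u, u ∈ I.active → u ∉ A → I.G.Adj v u → Z u c

/-- The assignments `(u, a)` with `u` outside `A` such that `a` is compatible with all colors that
`Z` announces to `u`. -/
def outerMask (H : SimpleGraph (Fin k)) (I : Inst k 𝒞) (A : Set (Fin I.n))
    (Z : Fin I.n → Fin k → Prop) : Fin I.n → Fin k → Prop :=
  fun u a => u ∉ A ∧ ∀ c, Z u c → H.Adj c a

/-- The announcements made by a list of assignments to the neighbours of the vertices in it. -/
def announce (I : Inst k 𝒞) (D : List (Fin I.n × Fin k)) (u : Fin I.n) (c : Fin k) : Prop :=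
  ∃ d, (d, c) ∈ D ∧ I.G.Adj d u

/-- On an edge from `u ∈ A` to a colored `v ∉ A`, the inner mask guarantees that the color of `u` is
announced to `v`, and the outer mask that the color of `v` is compatible with it. This holds for
every table `Z`, so wrong guesses still give safe colorings. -/
theorem safe_combine {A : Set (Fin I.n)} {Z : Fin I.n → Fin k → Prop} {φ ψ : I.Coloring}
    (hφ : (I.mask (I.innerMask A Z)).Safe H φ) (hψ : (I.mask (I.outerMask H A Z)).Safe H ψ) :
    I.Safe H (combine A φ ψ) := by
  rw [safe_mask] at hφ hψ
  have hAB : ∀ u v a b, u ∈ A → v ∉ A → φ u = some a → ψ v = some b → I.G.Adj u v →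
      H.Adj a b := by
    intro u v a b hu hv hua hvb huv
    exact (hψ.2 v b hvb).2 a ((hφ.2 u a hua).2 v (hψ.1.mem_active hvb) hv huv)
  constructor
  · intro u v a b hua hvb huv
    by_cases hu : u ∈ A <;> by_cases hv : v ∈ A <;>
      simp only [combine, hu, hv, if_true, if_false] at hua hvb
    · exact hφ.1.1 u v a b hua hvb huv
    · exact hAB u v a b hu hv hua hvb huv
    · exact (hAB v u b a hv hu hvb hua huv.symm).symm
    · exact hψ.1.1 u v a b hua hvb huv
  · intro v c hv
    by_cases hA : v ∈ A <;> simp only [combine, hA, if_true, if_false] at hv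
    · exact hφ.1.2 v c hv
    · exact hψ.1.2 v c hv

theorem combine_none_of_safe_mask {A : Set (Fin I.n)} {M : Fin I.n → Fin k → Prop}
    {φ : I.Coloring} (hM : ∀ v c, M v c → v ∈ A) (hφ : (I.mask M).Safe H φ) :
    combine A φ (fun _ => none) = φ := by
  funext v
  by_cases hA : v ∈ A
  · exact combine_of_mem hA
  · rw [combine_of_notMem hA]
    cases hv : φ v with
    | none => rfl
    | some c => exact absurd (hM v c ((safe_mask.1 hφ).2 v c hv)) hA

/-- If the restrictions of an optimum coloring `χ` to `A` and to the complement of `A` conform to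
the announcements `Z`, optimum colorings for the two masked instances combine to an optimum. -/
theorem opt_combine {A : Set (Fin I.n)} {Z : Fin I.n → Fin k → Prop} {φ ψ χ : I.Coloring}
    (hφ : (I.mask (I.innerMask A Z)).Safe H φ) (hψ : (I.mask (I.outerMask H A Z)).Safe H ψ)
    (hφχ : revenue I.rev (combine A χ fun _ => none) ≤ revenue I.rev φ)
    (hψχ : revenue I.rev (combine Aᶜ χ fun _ => none) ≤ revenue I.rev ψ) :
    revenue I.rev χ ≤ revenue I.rev (combine A φ ψ) := by
  have h1 : combine A χ χ = χ := by funext v; simp [combine]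
  rw [revenue_combine, combine_none_of_safe_mask (A := A) (fun v c h => h.1) hφ,
    combine_none_of_safe_mask (A := Aᶜ) (fun v c h => h.1) hψ, ← h1, revenue_combine]
  exact add_le_add hφχ hψχ

/-- For each color `c`, choose at most `R` vertices of the class of `c` in `A` that dominate the
active neighbours of this class outside `A`. Domination gives the inner mask. The outer mask holds
because only true assignments of `χ` are announced. -/
theorem exists_announcement (H : SimpleGraph (Fin k)) (s t : ℕ) : ∃ m : ℕ, ∀ (I : Inst k 𝒞),
    ¬ (leafCliqueStar s).IsIndContained I.G → ¬ (subdividedStar t).IsIndContained I.G →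
    ∀ (A : Set (Fin I.n)) (q : Fin I.n), (∀ v ∈ A, v = q ∨ I.G.Adj q v) →
      (∀ u, u ∉ A → ¬ I.G.Adj q u) → ∀ χ, I.Safe H χ → ∃ D : List (Fin I.n × Fin k),
        D.length ≤ m ∧
        (∀ v c, combine A χ (fun _ => none) v = some c → I.innerMask A (I.announce D) v c) ∧
        ∀ v c, combine Aᶜ χ (fun _ => none) v = some c → I.outerMask H A (I.announce D) v c := by
  classical
  obtain ⟨R, hR⟩ := exists_small_dominating.{0} s t
  refine ⟨k * R, fun I hL hS A q hA hq χ hχ => ?_⟩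
  have hD : ∀ c, ∃ D : Finset (Fin I.n), (∀ d ∈ D, d ∈ A ∧ χ d = some c) ∧ D.card ≤ R ∧
      ∀ v ∈ A, χ v = some c → ∀ u ∈ I.active, u ∉ A → I.G.Adj v u → ∃ d ∈ D, I.G.Adj d u := by
    intro c
    obtain ⟨D, hDS, hDR, hD⟩ := hR I.G hL hS q
      (Finset.univ.filter fun v => v ∈ A ∧ χ v = some c) {u | u ∈ I.active ∧ u ∉ A}
      (fun v hv => hA v (Finset.mem_filter.1 hv).2.1)
      (fun u hu v hv huv => H.loopless.irrefl _ (hχ.1 u v c c (Finset.mem_filter.1 hu).2.2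
        (Finset.mem_filter.1 hv).2.2 huv)) (fun u hu => hq u hu.2)
    refine ⟨D, fun d hd => (Finset.mem_filter.1 (hDS hd)).2, hDR,
      fun v hv hvc u hu huA huv => hD v (by simp [hv, hvc]) u ⟨hu, huA⟩ huv⟩
  choose D hDA hDR hD using hD
  refine ⟨(List.finRange k).flatMap fun c => (D c).toList.map fun d => (d, c), ?_, ?_, ?_⟩
  · rw [List.length_flatMap]
    refine (List.sum_le_card_nsmul _ R ?_).trans (by simp)
    intro x hx
    obtain ⟨c, -, rfl⟩ := List.mem_map.1 hx
    simpa using hDR c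
  · intro v c hv
    rw [combine_none_eq_some] at hv
    refine ⟨hv.1, fun u hu huA huv => ?_⟩
    obtain ⟨d, hd, hdu⟩ := hD c v hv.1 hv.2 u hu huA huv
    exact ⟨d, by simpa using hd, hdu⟩
  · intro v a hv
    rw [combine_none_eq_some] at hv
    refine ⟨hv.1, ?_⟩
    rintro c ⟨d, hd, hdv⟩
    have hd : d ∈ D c := by simpa using hd
    exact hχ.1 d v c a (hDA c d hd).2 hv.2 hdv

/-! ### Components -/

/-- The assignments to vertices of the component of `u` in the active subgraph. -/
def compMask (I : Inst k 𝒞) (u : Fin I.n) : Fin I.n → Fin k → Prop :=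
  fun v _ => v ∈ I.G.reach I.active u

/-- Vertices of one component have the same `compMask`, hence the same `ψ`. So reading at each
vertex its own `ψ` is consistent on each component. -/
theorem eq_of_reachable {ψ : Fin I.n → I.Coloring}
    (hψeq : ∀ u v, I.compMask u = I.compMask v → ψ u = ψ v) {u v : Fin I.n}
    (huv : (I.G.within I.active).Reachable u v) : ψ u = ψ v := by
  refine hψeq u v (funext fun w => funext fun _ => propext ?_)
  exact ⟨fun h => huv.symm.trans h, fun h => huv.trans h⟩

theorem safe_components {ψ : Fin I.n → I.Coloring} (hψ : ∀ u, I.Safe H (ψ u))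
    (hψeq : ∀ u v, I.compMask u = I.compMask v → ψ u = ψ v) : I.Safe H fun u => ψ u u := by
  refine ⟨fun u v a b hu hv huv => ?_, fun v c hv => (hψ v).2 v c hv⟩
  have : (I.G.within I.active).Adj u v :=
    ⟨huv, (hψ u).mem_active hu, (hψ v).mem_active hv⟩
  simp only [eq_of_reachable hψeq this.reachable] at hu
  exact (hψ v).1 u v a b hu hv huv

/-- The revenue is a sum over components, and on the component of `u` the glued coloring agrees with
the optimum `ψ u`. -/
theorem opt_components {ψ : Fin I.n → I.Coloring} (hψ : ∀ u, (I.mask (I.compMask u)).Opt H (ψ u))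
    (hψeq : ∀ u v, I.compMask u = I.compMask v → ψ u = ψ v) : I.Opt H fun u => ψ u u := by
  classical
  refine ⟨safe_components (fun u => (safe_mask.1 (hψ u).1).1) hψeq, fun χ hχ => ?_⟩
  · let κ := (I.G.within I.active).connectedComponentMk
    unfold revenue
    rw [← Finset.sum_fiberwise (g := κ), ← Finset.sum_fiberwise (g := κ)]
    refine Finset.sum_le_sum fun C _ => ?_
    obtain ⟨u, rfl⟩ := C.exists_rep
    have hκ : ∀ v, κ v = Quot.mk _ u ↔ v ∈ I.G.reach I.active u := fun v =>
      SimpleGraph.ConnectedComponent.eq.trans ⟨fun h => h.symm, fun h => h.symm⟩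
    have h1 : ∀ φ : I.Coloring, (∑ v with κ v = Quot.mk _ u, (φ v).elim 0 (I.rev v)) =
        revenue I.rev (combine (I.G.reach I.active u) φ fun _ => none) := by
      intro φ
      rw [Finset.sum_filter]
      refine Finset.sum_congr rfl fun v _ => ?_
      by_cases h : v ∈ I.G.reach I.active u <;> simp [combine, hκ, h]
    have h2 : combine (I.G.reach I.active u) (fun v => ψ v v) (fun _ => none) = ψ u := by
      rw [← combine_none_of_safe_mask (fun v c h => h) (hψ u).1]
      funext v
      by_cases h : v ∈ I.G.reach I.active u
      · rw [combine_of_mem h, combine_of_mem h, eq_of_reachable hψeq h]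
      · rw [combine_of_notMem h, combine_of_notMem h]
    rw [h1, h1 (fun v => ψ v v), h2]
    refine opt_mask (hψ u) (hχ.of_le fun v c hv => (combine_none_eq_some.1 hv).2)
      fun v c hv => (combine_none_eq_some.1 hv).1

end Inst

/-! ## Programs on instances -/

namespace PT

variable {X Y : Type*} {N : X → ℕ} {e g : X → Val} {n : X → ℕ}

/-- Extending the context by an index. -/
theorem up (hg : PT N e g) (n : X → ℕ) :
    PT (fun y : Σ x, Fin (n x) => N y.1) (withFin e n) fun y => g y.1 :=
  hg.weaken Sigma.fst _

/-- The last variable but one. -/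
theorem last₁ (e : X → Val) (n : X → ℕ) (n₁ : (Σ x, Fin (n x)) → ℕ)
    (N : (Σ y, Fin (n₁ y)) → ℕ) :
    PT N (withFin (withFin e n) n₁) fun y => encodeNat y.1.2 :=
  (fst _ _ _).comp (snd _ _ _)

/-- The last variable but two. -/
theorem last₂ (e : X → Val) (n : X → ℕ) (n₁ : (Σ x, Fin (n x)) → ℕ) (n₂ : (Σ y, Fin (n₁ y)) → ℕ)
    (N : (Σ y, Fin (n₂ y)) → ℕ) :
    PT N (withFin (withFin (withFin e n) n₁) n₂) fun y => encodeNat y.1.1.2 :=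
  (fst _ _ _).comp (PT.comp (fst _ _ _) (snd _ _ _))

/-- The last variable but three. -/
theorem last₃ (e : X → Val) (n : X → ℕ) (n₁ : (Σ x, Fin (n x)) → ℕ) (n₂ : (Σ y, Fin (n₁ y)) → ℕ)
    (n₃ : (Σ y, Fin (n₂ y)) → ℕ) (N : (Σ y, Fin (n₃ y)) → ℕ) :
    PT N (withFin (withFin (withFin (withFin e n) n₁) n₂) n₃) fun y => encodeNat y.1.1.1.2 :=
  (fst _ _ _).comp (PT.comp (fst _ _ _) (PT.comp (fst _ _ _) (snd _ _ _)))

/-- Calling a subroutine under a binder. -/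
theorem call_under {M : Y → ℕ} {a : Y → Val} {m : Y → ℕ} {b : (Σ y, Fin (m y)) → Val}
    (hb : PT (fun z => M z.1) (withFin a m) b) {φ : X → Y} (hf : PT N e fun x => a (φ x))
    (hM : ∀ x, M (φ x) ≤ N x) :
    PT (X := Σ x, Fin (m (φ x))) (fun z => N z.1) (withFin e fun x => m (φ x))
      fun z => b ⟨φ z.1, z.2⟩ :=
  hb.call (φ := fun z : Σ x, Fin (m (φ x)) => (⟨φ z.1, z.2⟩ : Σ y, Fin (m y)))
    ((hf.up _).pair (last _ _ _)) fun z => hM z.1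

end PT

namespace PD

variable {X Y : Type*} {N : X → ℕ} {e : X → Val} {n : X → ℕ}

theorem up {b : X → Prop} (hb : PD N e b) (n : X → ℕ) :
    PD (fun y : Σ x, Fin (n x) => N y.1) (PT.withFin e n) fun y => b y.1 :=
  PT.up hb n

theorem call_under {M : Y → ℕ} {a : Y → Val} {m : Y → ℕ} {b : (Σ y, Fin (m y)) → Prop}
    (hb : PD (fun z => M z.1) (PT.withFin a m) b) {φ : X → Y} (hf : PT N e fun x => a (φ x))
    (hM : ∀ x, M (φ x) ≤ N x) :
    PD (X := Σ x, Fin (m (φ x))) (fun z => N z.1) (PT.withFin e fun x => m (φ x))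
      fun z => b ⟨φ z.1, z.2⟩ :=
  PT.call_under hb hf hM

theorem up_under {b : (Σ x, Fin (n x)) → Prop} (hb : PD (fun z => N z.1) (PT.withFin e n) b)
    (m : X → ℕ) :
    PD (X := Σ y : (Σ x, Fin (m x)), Fin (n y.1)) (fun z => N z.1.1)
      (PT.withFin (PT.withFin e m) fun y => n y.1) fun z => b ⟨z.1.1, z.2⟩ :=
  hb.call_under (φ := fun y : Σ x, Fin (m x) => y.1) ((PT.id N e).up m) fun _ => le_rfl

end PD

/-- A table of truth values as a list of lists. -/
noncomputable def encodeTable {n k : ℕ} (Z : Fin n → Fin k → Prop) : Val :=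
  encodeList (List.ofFn fun u => encodeList (List.ofFn fun c => encodeProp (Z u c)))

section

variable {X : Type*} {N : X → ℕ} {e : X → Val} {n : X → ℕ} {k : ℕ}

theorem PT.table {Z : ∀ x, Fin (n x) → Fin k → Prop} (hn : PT N e fun x => encodeNat (n x))
    (hnN : PB N n)
    (hZ : PD (X := Σ y : (Σ x, Fin (n x)), Fin k) (fun z => N z.1.1)
      (PT.withFin (PT.withFin e n) fun _ => k) fun z => Z z.1.1 z.1.2 z.2) :
    PT N e fun x => encodeTable (Z x) :=
  PT.tabulate hn hnN (v := fun x u => encodeList (List.ofFn fun c => encodeProp (Z x u c)))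
    (PT.tabulate (n := fun _ => k) (PT.encodeNat_const _ _ k) (PB.const _ k)
      (v := fun (y : Σ x, Fin (n x)) c => encodeProp (Z y.1 y.2 c)) hZ)

theorem PD.table {Z : ∀ x, Fin (n x) → Fin k → Prop} (hnN : PB N n)
    (hZ : PT N e fun x => encodeTable (Z x)) {u : ∀ x, Fin (n x)} {c : X → Fin k}
    (hu : PT N e fun x => encodeNat (u x)) (hc : PT N e fun x => encodeNat (c x)) :
    PD N e fun x => Z x (u x) (c x) :=
  PD.nth (n := fun _ => k) (b := fun x c => Z x (u x) c) (i := c) (PB.const N k)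
    (PT.nth (v := fun x u => encodeList (List.ofFn fun c => encodeProp (Z x u c))) hnN hZ hu) hc

/-- The adjacency relation of a fixed graph. -/
theorem PD.pattern (H : SimpleGraph (Fin k)) {a c : X → Fin k}
    (ha : PT N e fun x => encodeNat (a x)) (hc : PT N e fun x => encodeNat (c x)) :
    PD N e fun x => H.Adj (a x) (c x) :=
  PD.table (n := fun _ => k) (Z := fun _ => H.Adj) (PB.const N k)
    (PT.ofFn_const fun a => PT.ofFn_const fun c => PD.const N e (H.Adj a c)) ha hc

theorem PT.coloring {φ : ∀ x, Fin (n x) → Option (Fin k)} (hn : PT N e fun x => encodeNat (n x))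
    (hnN : PB N n)
    (hφ : PT (fun y => N y.1) (PT.withFin e n)
      fun y => encodeNat ((φ y.1 y.2).elim 0 fun c => c.val + 1)) :
    PT N e fun x => encodeColoring (φ x) :=
  PT.tabulate hn hnN hφ

theorem PT.color {φ : ∀ x, Fin (n x) → Option (Fin k)} (hnN : PB N n)
    (hφ : PT N e fun x => encodeColoring (φ x)) {u : ∀ x, Fin (n x)}
    (hu : PT N e fun x => encodeNat (u x)) :
    PT N e fun x => encodeNat ((φ x (u x)).elim 0 fun c => c.val + 1) :=
  PT.nth (v := fun x u => encodeNat ((φ x u).elim 0 fun c => c.val + 1)) hnN hφ hu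

end

/-! ### Polynomial-time operations on instances and colorings. -/

namespace Inst

variable {k : ℕ} {𝒞 : ∀ n : ℕ, SimpleGraph (Fin n) → Prop}

/-- The encoding of an instance. -/
noncomputable abbrev enc (I : Inst k 𝒞) : Val := encodeInstance I.G I.rev

/-- The instance `I` is available in the context. -/
structure Avail {X : Type*} (N : X → ℕ) (e : X → Val) (I : X → Inst k 𝒞) : Prop where
  bound : PB N fun x => (I x).n
  enc : PT N e fun x => (I x).enc

namespace Avail

variable {X Y : Type*} {N : X → ℕ} {e : X → Val} {I : X → Inst k 𝒞} {H : SimpleGraph (Fin k)}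

theorem up (hI : Avail N e I) (n : X → ℕ) :
    Avail (fun y : Σ x, Fin (n x) => N y.1) (PT.withFin e n) fun y => I y.1 :=
  ⟨hI.bound.reindex _, hI.enc.up n⟩

theorem weaken (hI : Avail N e I) (φ : Y → X) (w : Y → Val) :
    Avail (fun y => N (φ y)) (fun y => .pair (e (φ y)) (w y)) fun y => I (φ y) :=
  ⟨hI.bound.reindex _, hI.enc.weaken φ w⟩

theorem size (hI : Avail N e I) : PT N e fun x => encodeNat (I x).n :=
  (PT.length hI.enc (by simpa using hI.bound)).congr fun x => by simp

theorem entry (hI : Avail N e I) {u : ∀ x, Fin (I x).n}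
    (hu : PT N e fun x => encodeNat (u x)) :
    PT N e fun x => .pair
      (encodeList (List.ofFn fun v => encodeProp ((I x).G.Adj (u x) v)))
      (encodeList (List.ofFn fun c => .num ((I x).rev (u x) c))) :=
  PT.nth (v := fun x (u : Fin (I x).n) => .pair
      (encodeList (List.ofFn fun v => encodeProp ((I x).G.Adj u v)))
      (encodeList (List.ofFn fun c => .num ((I x).rev u c)))) hI.bound hI.enc hu

theorem adj (hI : Avail N e I) {u v : ∀ x, Fin (I x).n}
    (hu : PT N e fun x => encodeNat (u x)) (hv : PT N e fun x => encodeNat (v x)) :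
    PD N e fun x => (I x).G.Adj (u x) (v x) :=
  PD.nth (b := fun x v => (I x).G.Adj (u x) v) hI.bound (hI.entry hu).head hv

theorem rev (hI : Avail N e I) {u : ∀ x, Fin (I x).n} {c : X → Fin k}
    (hu : PT N e fun x => encodeNat (u x)) (hc : PT N e fun x => encodeNat (c x)) :
    PT N e fun x => .num ((I x).rev (u x) (c x)) :=
  PT.nth (n := fun _ => k) (v := fun x c => .num ((I x).rev (u x) c)) (i := c) (PB.const N k)
    (hI.entry hu).tail hc

theorem vertex_eq (hI : Avail N e I) {u v : ∀ x, Fin (I x).n}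
    (hu : PT N e fun x => encodeNat (u x)) (hv : PT N e fun x => encodeNat (v x)) :
    PD N e fun x => u x = v x :=
  PD.fin_eq hI.bound hu hv

theorem forall_vertex (hI : Avail N e I) {b : ∀ x, Fin (I x).n → Prop}
    (hb : PD (fun y => N y.1) (PT.withFin e fun x => (I x).n) fun y => b y.1 y.2) :
    PD N e fun x => ∀ i, b x i :=
  PD.forall_fin hI.size hI.bound hb

theorem exists_vertex (hI : Avail N e I) {b : ∀ x, Fin (I x).n → Prop}
    (hb : PD (fun y => N y.1) (PT.withFin e fun x => (I x).n) fun y => b y.1 y.2) :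
    PD N e fun x => ∃ i, b x i :=
  PD.exists_fin hI.size hI.bound hb

theorem mem_active (hI : Avail N e I) {u : ∀ x, Fin (I x).n}
    (hu : PT N e fun x => encodeNat (u x)) : PD N e fun x => u x ∈ (I x).active :=
  PD.exists_fin (n := fun _ => k) (b := fun x c => 0 ≤ (I x).rev (u x) c)
    (PT.encodeNat_const N e k) (PB.const N k)
    (PD.le (PT.zero _ _) ((hI.up _).rev (hu.up _) (PT.last _ _ _)))

/-- Changing the graph and the revenues. -/
theorem rebuild (hI : Avail N e I) {G : ∀ x, SimpleGraph (Fin (I x).n)}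
    {r : ∀ x, Fin (I x).n → Fin k → ℝ}
    (hG : PD (X := Σ y : (Σ x, Fin (I x).n), Fin (I y.1).n) (fun z => N z.1.1)
      (PT.withFin (PT.withFin e fun x => (I x).n) fun y => (I y.1).n)
      fun z => (G z.1.1).Adj z.1.2 z.2)
    (hr : PT (X := Σ y : (Σ x, Fin (I x).n), Fin k) (fun z => N z.1.1)
      (PT.withFin (PT.withFin e fun x => (I x).n) fun _ => k) fun z => .num (r z.1.1 z.1.2 z.2)) :
    PT N e fun x => encodeInstance (G x) (r x) :=
  PT.tabulate hI.size hI.bound (v := fun x u => .pair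
      (encodeList (List.ofFn fun v => encodeProp ((G x).Adj u v)))
      (encodeList (List.ofFn fun c => .num (r x u c))))
    ((PT.tabulate (hI.up _).size (hI.up _).bound
      (v := fun (y : Σ x, Fin (I x).n) v => encodeProp ((G y.1).Adj y.2 v)) hG).pair
    (PT.tabulate (n := fun _ => k) (PT.encodeNat_const _ _ k) (PB.const _ k)
      (v := fun (y : Σ x, Fin (I x).n) c => .num (r y.1 y.2 c)) hr))

theorem mask (hI : Avail N e I) {M : ∀ x, Fin (I x).n → Fin k → Prop}
    (hM : PD (X := Σ y : (Σ x, Fin (I x).n), Fin k) (fun z => N z.1.1)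
      (PT.withFin (PT.withFin e fun x => (I x).n) fun _ => k) fun z => M z.1.1 z.1.2 z.2) :
    Avail N e fun x => (I x).mask (M x) :=
  ⟨hI.bound, hI.rebuild ((hI.up _).up _ |>.adj (PT.last₁ _ _ _ _) (PT.last _ _ _))
    ((PT.ite hM (((hI.up _).up _).rev (u := fun z => z.1.2) (c := fun z => z.2)
      (PT.last₁ _ _ _ _) (PT.last _ _ _)) (PT.neg_one _ _)).congr fun z => by
        simp only [Inst.mask]; split_ifs <;> rfl)⟩

theorem within (hI : Avail N e I) :
    PT N e fun x => encodeInstance ((I x).G.within (I x).active) (I x).rev :=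
  hI.rebuild (((hI.up _).up _ |>.adj (PT.last₁ _ _ _ _) (PT.last _ _ _)).and
    (((hI.up _).up _ |>.mem_active (PT.last₁ _ _ _ _)).and
      ((hI.up _).up _ |>.mem_active (PT.last _ _ _))))
    (((hI.up fun x => (I x).n).up fun _ => k).rev (u := fun z => z.1.2) (c := fun z => z.2)
      (PT.last₁ _ _ _ _) (PT.last _ _ _))

theorem none (hI : Avail N e I) : PT N e fun x => encodeColoring fun _ : Fin (I x).n =>
    (Option.none : Option (Fin k)) :=
  PT.coloring (φ := fun x _ => Option.none) hI.size hI.bound (PT.nil _ _)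

theorem combine (hI : Avail N e I) {A : ∀ x, Set (Fin (I x).n)} {φ ψ : ∀ x, (I x).Coloring}
    (hA : PD (fun y => N y.1) (PT.withFin e fun x => (I x).n) fun y => y.2 ∈ A y.1)
    (hφ : PT N e fun x => encodeColoring (φ x)) (hψ : PT N e fun x => encodeColoring (ψ x)) :
    PT N e fun x => encodeColoring (combine (A x) (φ x) (ψ x)) :=
  PT.coloring (φ := fun x => _root_.combine (A x) (φ x) (ψ x)) hI.size hI.bound
    ((PT.ite hA (PT.color (hI.up _).bound (hφ.up _) (PT.last _ _ _))
      (PT.color (hI.up _).bound (hψ.up _) (PT.last _ _ _))).congr fun y => by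
        by_cases h : y.2 ∈ A y.1 <;> simp [_root_.combine, h])

theorem revenue (hI : Avail N e I) {φ : ∀ x, (I x).Coloring}
    (hφ : PT N e fun x => encodeColoring (φ x)) :
    PT N e fun x => .num (revenue (I x).rev (φ x)) := by
  refine PT.sum (r := fun x v => (φ x v).elim 0 ((I x).rev v)) hI.size hI.bound ?_
  have hcol := PT.color (hI.up _).bound (hφ.up _) (PT.last e (fun x => (I x).n) fun y => N y.1)
  have hrow := ((hI.up _).entry (PT.last e (fun x => (I x).n) fun y => N y.1)).tail
  -- For `k > 0`, color `0` stands in at uncolored vertices to give a total index; the test on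
  -- `hcol` discards its revenue. For `k = 0` there is no such default, but nothing can be colored
  -- either.
  by_cases hk : k = 0
  · subst hk
    exact (PT.zero _ _).congr fun y => by
      cases φ y.1 y.2 with
      | none => rfl
      | some c => exact c.elim0
  · have hc : PT (fun y : Σ x, Fin (I x).n => N y.1) (PT.withFin e fun x => (I x).n) fun y =>
        encodeNat ((φ y.1 y.2).getD ⟨0, Nat.pos_of_ne_zero hk⟩).val :=
      (PT.encodeNat_pred hcol).congr fun y => by cases φ y.1 y.2 <;> rfl
    exact (PT.ite (PD.ne_nil hcol) ((hI.up _).rev (PT.last _ _ _) hc) (PT.zero _ _)).congr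
      fun y => by cases φ y.1 y.2 <;> simp [encodeNat]

end Avail

open Classical in
/-- The coloring of larger revenue. -/
noncomputable def better (I : Inst k 𝒞) (φ ψ : I.Coloring) : I.Coloring :=
  if revenue I.rev φ ≤ revenue I.rev ψ then ψ else φ

theorem better_eq (I : Inst k 𝒞) (φ ψ : I.Coloring) : I.better φ ψ = φ ∨ I.better φ ψ = ψ := by
  unfold better; split_ifs <;> simp

theorem le_better_left (I : Inst k 𝒞) (φ ψ : I.Coloring) :
    revenue I.rev φ ≤ revenue I.rev (I.better φ ψ) := by
  unfold better; split_ifs with h <;> simp [h]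

theorem le_better_right (I : Inst k 𝒞) (φ ψ : I.Coloring) :
    revenue I.rev ψ ≤ revenue I.rev (I.better φ ψ) := by
  unfold better; split_ifs with h
  · rfl
  · exact (not_le.1 h).le

namespace Avail

variable {X Y : Type*} {N : X → ℕ} {e : X → Val} {I : X → Inst k 𝒞} {H : SimpleGraph (Fin k)}

theorem better (hI : Avail N e I) {φ ψ : ∀ x, (I x).Coloring}
    (hφ : PT N e fun x => encodeColoring (φ x)) (hψ : PT N e fun x => encodeColoring (ψ x)) :
    PT N e fun x => encodeColoring ((I x).better (φ x) (ψ x)) :=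
  (PT.ite (PD.le (hI.revenue hφ) (hI.revenue hψ)) hψ hφ).congr fun x => by
    unfold Inst.better; split_ifs <;> rfl

/-- The best one of a family of colorings. -/
theorem exists_best (hI : Avail N e I) {n : X → ℕ} (hn : PT N e fun x => encodeNat (n x))
    (hnN : PB N n) {φ₀ : ∀ x, (I x).Coloring} {φ : ∀ x, Fin (n x) → (I x).Coloring}
    (h₀ : PT N e fun x => encodeColoring (φ₀ x))
    (hφ : PT (fun y => N y.1) (PT.withFin e n) fun y => encodeColoring (φ y.1 y.2)) :
    ∃ ψ : ∀ x, (I x).Coloring, (PT N e fun x => encodeColoring (ψ x)) ∧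
      ∀ x, (ψ x = φ₀ x ∨ ∃ i, ψ x = φ x i) ∧
        _root_.revenue (I x).rev (φ₀ x) ≤ _root_.revenue (I x).rev (ψ x) ∧
        ∀ i, _root_.revenue (I x).rev (φ x i) ≤ _root_.revenue (I x).rev (ψ x) := by
  refine ⟨_, PT.foldr (S := fun x => (I x).Coloring) (enc := fun x => encodeColoring)
    (step := fun x i χ => (I x).better (φ x i) χ) (init := φ₀) hn hnN h₀ ?_, fun x => ?_⟩
  · have hI' : Avail (X := Σ x, Fin (n x) × (I x).Coloring) (fun y => N y.1)
        (fun y => .pair (e y.1) (.pair (encodeNat y.2.1) (encodeColoring y.2.2)))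
        fun y => I y.1 := hI.weaken _ _
    exact hI'.better (φ := fun y => φ y.1 y.2.1) (ψ := fun y => y.2.2)
      (PT.withState (S := fun x => (I x).Coloring) (enc := fun x => encodeColoring) hφ)
      (PT.state (S := fun x => (I x).Coloring) (enc := fun x => encodeColoring))
  · have key : ∀ l : List (Fin (n x)),
        (l.foldr (fun i χ => (I x).better (φ x i) χ) (φ₀ x) = φ₀ x ∨
          ∃ i, l.foldr (fun i χ => (I x).better (φ x i) χ) (φ₀ x) = φ x i) ∧
        _root_.revenue (I x).rev (φ₀ x) ≤
          _root_.revenue (I x).rev (l.foldr (fun i χ => (I x).better (φ x i) χ) (φ₀ x)) ∧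
        ∀ i ∈ l, _root_.revenue (I x).rev (φ x i) ≤
          _root_.revenue (I x).rev (l.foldr (fun i χ => (I x).better (φ x i) χ) (φ₀ x)) := by
      intro l
      induction l with
      | nil => exact ⟨Or.inl rfl, le_rfl, by simp⟩
      | cons a l ih =>
        rw [List.foldr_cons]
        refine ⟨?_, ih.2.1.trans (le_better_right _ _ _), ?_⟩
        · rcases better_eq (I x) (φ x a) (l.foldr (fun i χ => (I x).better (φ x i) χ) (φ₀ x))
            with h | h
          · exact Or.inr ⟨a, h⟩
          · rw [h]; exact ih.1
        · intro i hi
          rcases List.mem_cons.1 hi with rfl | hi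
          · exact le_better_left _ _ _
          · exact (ih.2.2 i hi).trans (le_better_right _ _ _)
    have := key (List.finRange (n x))
    exact ⟨this.1, this.2.1, fun i => this.2.2 i (List.mem_finRange i)⟩

end Avail

/-- Truth tables indexed by vertices and colors. -/
abbrev Table (I : Inst k 𝒞) := Fin I.n → Fin k → Prop

/-! ### Trying all announcements made by boundedly many assignments. -/

namespace Avail

variable {X Y : Type*} {N : X → ℕ} {e : X → Val} {I : X → Inst k 𝒞}

/-- Choosing the best announcement made by at most `m` assignments. -/
theorem exists_best_announcement (hI : Avail N e I) {φ : ∀ x, (I x).Table → (I x).Coloring}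
    (hφ : PT (X := Σ x, (I x).Table) (fun y => N y.1)
      (fun y => .pair (e y.1) (encodeTable y.2)) fun y => encodeColoring (φ y.1 y.2)) (m : ℕ) :
    ∃ ψ : ∀ x, (I x).Coloring, (PT N e fun x => encodeColoring (ψ x)) ∧
      ∀ x, (∃ Z, ψ x = φ x Z) ∧ ∀ D, D.length ≤ m →
        _root_.revenue (I x).rev (φ x ((I x).announce D)) ≤ _root_.revenue (I x).rev (ψ x) := by
  -- For the induction on `m`, the search starts from an arbitrary table `Z` of announcements
  -- already made, and each level adds those of one assignment.
  suffices h : ∃ ψ : ∀ x, (I x).Table → (I x).Coloring,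
      (PT (X := Σ x, (I x).Table) (fun y => N y.1)
        (fun y => .pair (e y.1) (encodeTable y.2)) fun y => encodeColoring (ψ y.1 y.2)) ∧
      ∀ x Z, (∃ Z', ψ x Z = φ x Z') ∧ ∀ D, D.length ≤ m →
        _root_.revenue (I x).rev (φ x fun u c => Z u c ∨ (I x).announce D u c) ≤
          _root_.revenue (I x).rev (ψ x Z) by
    obtain ⟨ψ, hψ, h⟩ := h
    refine ⟨fun x => ψ x fun _ _ => False,
      hψ.call (φ := fun x => (⟨x, fun _ _ => False⟩ : Σ x, (I x).Table))
        ((PT.id N e).pair (PT.table hI.size hI.bound (PD.const _ _ False))) fun _ => le_rfl,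
      fun x => ⟨(h x _).1, fun D hD => ?_⟩⟩
    simpa using (h x fun _ _ => False).2 D hD
  have hI' : Avail (X := Σ x, (I x).Table) (fun y => N y.1)
      (fun y => .pair (e y.1) (encodeTable y.2)) fun y => I y.1 := hI.weaken _ _
  induction m with
  | zero =>
    refine ⟨φ, hφ, fun x Z => ⟨⟨Z, rfl⟩, fun D hD => ?_⟩⟩
    rw [List.eq_nil_of_length_eq_zero (Nat.le_zero.1 hD)]
    simp [announce]
  | succ m ih =>
    obtain ⟨χ, hχ, h⟩ := ih
    let upd : ∀ x, (I x).Table → Fin (I x).n → Fin k → (I x).Table :=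
      fun x Z d c u c' => Z u c' ∨ (c' = c ∧ (I x).G.Adj d u)
    have hupd : PT (X := Σ z : (Σ y : (Σ x, (I x).Table), Fin (I y.1).n), Fin k)
        (fun w => N w.1.1.1) (PT.withFin (PT.withFin
          (fun y : Σ x, (I x).Table => .pair (e y.1) (encodeTable y.2)) fun y => (I y.1).n)
          fun _ => k) fun w => encodeColoring (χ w.1.1.1 (upd w.1.1.1 w.1.1.2 w.1.2 w.2)) := by
      refine hχ.call (φ := fun w : Σ z : (Σ y : (Σ x, (I x).Table), Fin (I y.1).n), Fin k =>
        (⟨w.1.1.1, upd w.1.1.1 w.1.1.2 w.1.2 w.2⟩ : Σ x, (I x).Table))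
        (PT.pair (((PT.fst (fun y : Σ x, (I x).Table => N y.1) (fun y => e y.1)
          fun y => encodeTable y.2).up _).up _) ?_) fun _ => le_rfl
      have hI2 := (hI'.up fun y => (I y.1).n).up fun _ => k
      have hZ := PT.snd (fun y : Σ x, (I x).Table => N y.1) (fun y => e y.1)
        fun y => encodeTable y.2
      refine PT.table (Z := fun w : Σ z : (Σ y : (Σ x, (I x).Table), Fin (I y.1).n), Fin k =>
        upd w.1.1.1 w.1.1.2 w.1.2 w.2) hI2.size hI2.bound ?_
      refine PD.or (PD.table (n := fun w : Σ z : (Σ w : (Σ z : (Σ y : (Σ x, (I x).Table),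
          Fin (I y.1).n), Fin k), Fin (I w.1.1.1).n), Fin k => (I w.1.1.1.1.1).n)
          (Z := fun w => w.1.1.1.1.2) ((hI2.up _).up _).bound
          ((((hZ.up _).up _).up _).up _) (PT.last₁ _ _ _ _) (PT.last _ _ _))
        (PD.and (PD.fin_eq (n := fun _ => k) (PB.const _ k) (PT.last _ _ _)
          (PT.last₂ _ _ _ _ _))
          (((hI2.up fun w => (I w.1.1.1).n).up fun _ => k).adj (u := fun w => w.1.1.1.2) (v := fun w => w.1.2)
            (PT.last₃ _ _ _ _ _ _)
            (PT.last₁ _ _ _ _)))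
    -- Maximize over the color `c` of the added assignment, then over its vertex `d`. The initial
    -- candidate `χ` adds nothing and covers the empty list.
    obtain ⟨ψ₁, hψ₁, h₁⟩ := (hI'.up fun y => (I y.1).n).exists_best (n := fun _ => k)
      (PT.encodeNat_const _ _ k) (PB.const _ k) (hχ.up _)
      (φ := fun z c => χ z.1.1 (upd z.1.1 z.1.2 z.2 c)) hupd
    obtain ⟨ψ, hψ, h₂⟩ := hI'.exists_best hI'.size hI'.bound hχ (φ := fun y d => ψ₁ ⟨y, d⟩) hψ₁
    refine ⟨fun x Z => ψ ⟨x, Z⟩, hψ, fun x Z => ⟨?_, fun D hD => ?_⟩⟩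
    · dsimp only
      rcases (h₂ ⟨x, Z⟩).1 with h0 | ⟨d, h0⟩
      · rw [h0]; exact (h x Z).1
      · rw [h0]
        rcases (h₁ ⟨⟨x, Z⟩, d⟩).1 with h1 | ⟨c, h1⟩
        · rw [h1]; exact (h x Z).1
        · rw [h1]; exact (h x _).1
    · rcases D with _ | ⟨⟨d, c⟩, D⟩
      · exact ((h x Z).2 [] (Nat.zero_le _)).trans (h₂ ⟨x, Z⟩).2.1
      · have e1 : (fun u c' => Z u c' ∨ (I x).announce ((d, c) :: D) u c') =
            fun u c' => upd x Z d c u c' ∨ (I x).announce D u c' := by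
          funext u c'
          simp only [upd, announce, List.mem_cons, Prod.mk.injEq, or_and_right, exists_or,
            or_assoc, eq_iff_iff]
          refine or_congr_right (or_congr_left ?_)
          constructor
          · rintro ⟨d', ⟨rfl, rfl⟩, h⟩; exact ⟨rfl, h⟩
          · rintro ⟨rfl, h⟩; exact ⟨d, ⟨rfl, rfl⟩, h⟩
        rw [e1]
        exact ((h x _).2 D (Nat.le_of_succ_le_succ hD)).trans
          (((h₁ ⟨⟨x, Z⟩, d⟩).2.2 c).trans ((h₂ ⟨x, Z⟩).2.2 d))

end Avail

end Inst

/-! ### Programs for masks, splitting and reachability. -/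

namespace Inst

variable {k : ℕ} {𝒞 : ∀ n : ℕ, SimpleGraph (Fin n) → Prop}

theorem opt_mask_mask {I : Inst k 𝒞} {H : SimpleGraph (Fin k)} {M M' : I.Table} {φ : I.Coloring}
    (hφ : ((I.mask M).mask M').Opt H φ) {ψ : I.Coloring} (hψ : I.Safe H ψ)
    (hM : ∀ v c, ψ v = some c → M v c) (hM' : ∀ v c, ψ v = some c → M' v c) :
    revenue I.rev ψ ≤ revenue I.rev φ := by
  rw [← revenue_mask hM, ← revenue_mask (safe_mask.1 (safe_mask.1 hφ.1).1).2]
  exact opt_mask (I := I.mask M) hφ (safe_mask.2 ⟨hψ, hM⟩) hM'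

namespace Avail

variable {X Y : Type*} {N : X → ℕ} {e : X → Val} {I : X → Inst k 𝒞}

/-- The context extended by a masked instance. -/
noncomputable abbrev withMask (e : X → Val) (I : X → Inst k 𝒞) : (Σ x, (I x).Table) → Val :=
  fun y => .pair (e y.1) ((I y.1).mask y.2).enc

theorem ofMask (hI : PB N fun x => (I x).n) :
    Avail (fun y : Σ x, (I x).Table => N y.1) (withMask e I) fun y => (I y.1).mask y.2 :=
  ⟨hI.reindex _, PT.snd _ _ _⟩

theorem innerMask (hI : Avail N e I) {A : ∀ x, Set (Fin (I x).n)}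
    (hA : PD (fun y => N y.1) (PT.withFin e fun x => (I x).n) fun y => y.2 ∈ A y.1)
    {Z : ∀ x, (I x).Table} (hZ : PT N e fun x => encodeTable (Z x)) :
    Avail N e fun x => (I x).mask ((I x).innerMask (A x) (Z x)) := by
  refine hI.mask (PD.and ((hA.up fun _ => k).congr fun z => Iff.rfl) ?_)
  have hI2 := (hI.up fun x => (I x).n).up fun _ => k
  refine hI2.forall_vertex (b := fun (w : Σ y : (Σ x, Fin (I x).n), Fin k) u =>
    u ∈ (I w.1.1).active → u ∉ A w.1.1 → (I w.1.1).G.Adj w.1.2 u → Z w.1.1 u w.2) ?_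
  have hI3 := hI2.up fun z => (I z.1.1).n
  refine (hI3.mem_active (PT.last _ _ _)).imp (PD.imp (PD.not ?_) (PD.imp
    (hI3.adj (PT.last₂ _ _ _ _ _) (PT.last _ _ _)) ?_))
  · exact PD.up_under (X := Σ x, Fin (I x).n) (N := fun y => N y.1) (n := fun y => (I y.1).n)
      (b := fun z => z.2 ∈ A z.1.1) (hA.up_under fun x => (I x).n) fun _ => k
  · exact PD.table (n := fun w : Σ z : (Σ y : (Σ x, Fin (I x).n), Fin k), Fin (I z.1.1).n =>
      (I w.1.1.1).n) (Z := fun w => Z w.1.1.1) hI3.bound (((hZ.up _).up _).up _) (PT.last _ _ _)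
      (PT.last₁ _ _ _ _)

theorem outerMask (H : SimpleGraph (Fin k)) (hI : Avail N e I) {A : ∀ x, Set (Fin (I x).n)}
    (hA : PD (fun y => N y.1) (PT.withFin e fun x => (I x).n) fun y => y.2 ∈ A y.1)
    {Z : ∀ x, (I x).Table} (hZ : PT N e fun x => encodeTable (Z x)) :
    Avail N e fun x => (I x).mask (Inst.outerMask H (I x) (A x) (Z x)) := by
  refine hI.mask (PD.and ((hA.up fun _ => k).not.congr fun z => Iff.rfl) ?_)
  have hI2 := (hI.up fun x => (I x).n).up fun _ => k
  refine PD.forall_fin (n := fun _ => k) (b := fun (w : Σ y : (Σ x, Fin (I x).n), Fin k) c =>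
    Z w.1.1 w.1.2 c → H.Adj c w.2) (PT.encodeNat_const _ _ k) (PB.const _ k) ?_
  refine PD.imp ?_ (PD.pattern H (PT.last _ _ _) (PT.last₁ _ _ _ _))
  exact PD.table (n := fun w : Σ z : (Σ y : (Σ x, Fin (I x).n), Fin k), Fin k =>
      (I w.1.1.1).n) (Z := fun w => Z w.1.1.1) (hI2.up _).bound (((hZ.up _).up _).up _)
      (PT.last₂ _ _ _ _ _) (PT.last _ _ _)

/-- Solving the two masked instances for the best announcement. -/
theorem exists_split (H : SimpleGraph (Fin k)) (hI : Avail N e I) {A : ∀ x, Set (Fin (I x).n)}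
    (hA : PD (fun y => N y.1) (PT.withFin e fun x => (I x).n) fun y => y.2 ∈ A y.1)
    {φ ψ : ∀ x, (I x).Table → (I x).Coloring}
    (hφ : PT (X := Σ x, (I x).Table) (fun y => N y.1) (withMask e I)
      fun y => encodeColoring (φ y.1 y.2))
    (hψ : PT (X := Σ x, (I x).Table) (fun y => N y.1) (withMask e I)
      fun y => encodeColoring (ψ y.1 y.2)) (m : ℕ) :
    ∃ χ : ∀ x, (I x).Coloring, (PT N e fun x => encodeColoring (χ x)) ∧ ∀ x,
      (∃ Z, χ x = _root_.combine (A x) (φ x ((I x).innerMask (A x) Z))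
        (ψ x (Inst.outerMask H (I x) (A x) Z))) ∧
      ∀ D, D.length ≤ m →
        _root_.revenue (I x).rev (_root_.combine (A x)
          (φ x ((I x).innerMask (A x) ((I x).announce D)))
          (ψ x (Inst.outerMask H (I x) (A x) ((I x).announce D)))) ≤
        _root_.revenue (I x).rev (χ x) := by
  refine hI.exists_best_announcement (φ := fun x Z => _root_.combine (A x)
    (φ x ((I x).innerMask (A x) Z)) (ψ x (Inst.outerMask H (I x) (A x) Z))) ?_ m
  have hI' : Avail (X := Σ x, (I x).Table) (fun y => N y.1)
      (fun y => .pair (e y.1) (encodeTable y.2)) fun y => I y.1 := hI.weaken _ _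
  have he := PT.fst (fun y : Σ x, (I x).Table => N y.1) (fun y => e y.1) fun y => encodeTable y.2
  have hZ := PT.snd (fun y : Σ x, (I x).Table => N y.1) (fun y => e y.1) fun y => encodeTable y.2
  have hA' := hA.call_under (φ := fun y : Σ x, (I x).Table => y.1) he fun _ => le_rfl
  refine hI'.combine (A := fun y => A y.1) hA' ?_ ?_
  · exact hφ.call (φ := fun y : Σ x, (I x).Table =>
      (⟨y.1, (I y.1).innerMask (A y.1) y.2⟩ : Σ x, (I x).Table))
      (he.pair (hI'.innerMask (A := fun y => A y.1) (Z := fun y => y.2) hA' hZ).enc)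
      fun _ => le_rfl
  · exact hψ.call (φ := fun y : Σ x, (I x).Table =>
      (⟨y.1, Inst.outerMask H (I y.1) (A y.1) y.2⟩ : Σ x, (I x).Table))
      (he.pair (hI'.outerMask H (A := fun y => A y.1) (Z := fun y => y.2) hA' hZ).enc)
      fun _ => le_rfl

/-- Breadth-first search. -/
theorem mem_reach (hI : Avail N e I) {u v : ∀ x, Fin (I x).n}
    (hu : PT N e fun x => encodeNat (u x)) (hv : PT N e fun x => encodeNat (v x)) :
    PD N e fun x => v x ∈ (I x).G.reach (I x).active (u x) := by
  classical
  let encS : ∀ x, (Fin (I x).n → Prop) → Val := fun x R =>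
    encodeList (List.ofFn fun v => encodeProp (R v))
  -- The index of the round is ignored; it only makes the search run `n` rounds. After `l` rounds
  -- exactly the ends of walks of length at most `l` are marked.
  let step : ∀ x, Fin (I x).n → (Fin (I x).n → Prop) → Fin (I x).n → Prop := fun x _ R v =>
    R v ∨ ∃ w, R w ∧ (I x).G.Adj w v ∧ w ∈ (I x).active ∧ v ∈ (I x).active
  have h0 : PT N e fun x => encS x fun v => u x = v :=
    PT.tabulate (v := fun x v => encodeProp (u x = v)) hI.size hI.bound
      ((hI.up _).vertex_eq (hu.up _) (PT.last _ _ _))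
  have h := PT.foldr (S := fun x => Fin (I x).n → Prop) (enc := encS) (step := step) hI.size
    hI.bound h0 (by
      have hI' : Avail (X := Σ x, Fin (I x).n × (Fin (I x).n → Prop)) (fun y => N y.1)
        (fun y => .pair (e y.1) (.pair (encodeNat y.2.1) (encS y.1 y.2.2)))
        fun y => I y.1 := hI.weaken _ _
      have hR : PT (X := Σ x, Fin (I x).n × (Fin (I x).n → Prop)) (fun y => N y.1)
        (fun y => .pair (e y.1) (.pair (encodeNat y.2.1) (encS y.1 y.2.2)))
        fun y => encS y.1 y.2.2 :=
        PT.state (S := fun x => Fin (I x).n → Prop) (enc := encS)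
      refine PT.tabulate (v := fun (y : Σ x, Fin (I x).n × (Fin (I x).n → Prop)) v =>
        encodeProp (step y.1 y.2.1 y.2.2 v)) hI'.size hI'.bound ?_
      have hI2 := hI'.up fun y => (I y.1).n
      have hI3 := hI2.up fun y => (I y.1.1).n
      refine PD.or (PD.nth (b := fun z v => z.1.2.2 v) hI2.bound (hR.up _) (PT.last _ _ _))
        (hI2.exists_vertex (PD.and (PD.nth (b := fun z v => z.1.1.2.2 v) hI3.bound
          ((hR.up _).up _) (PT.last _ _ _)) ((hI3.adj (PT.last _ _ _) (PT.last₁ _ _ _ _)).and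
            ((hI3.mem_active (PT.last _ _ _)).and (hI3.mem_active (PT.last₁ _ _ _ _))))))
    )
  refine (PD.nth hI.bound h hv).congr fun x => ?_
  have key : ∀ (l : List (Fin (I x).n)) v, l.foldr (step x) (fun v => u x = v) v ↔
      ∃ p : ((I x).G.within (I x).active).Walk (u x) v, p.length ≤ l.length := by
    intro l
    induction l with
    | nil =>
      intro v
      constructor
      · rintro rfl
        exact ⟨.nil, le_rfl⟩
      · rintro ⟨p, hp⟩
        exact SimpleGraph.Walk.eq_of_length_eq_zero (Nat.le_zero.1 hp)
    | cons a l ih =>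
      intro v
      rw [List.foldr_cons, List.length_cons]
      constructor
      · rintro (h | ⟨w, hw, hwv⟩)
        · obtain ⟨p, hp⟩ := (ih v).1 h
          exact ⟨p, by omega⟩
        · obtain ⟨p, hp⟩ := (ih w).1 hw
          have hadj : ((I x).G.within (I x).active).Adj w v := hwv
          exact ⟨p.concat hadj, by rw [SimpleGraph.Walk.length_concat]; omega⟩
      · rintro ⟨p, hp⟩
        rcases Nat.lt_or_ge l.length p.length with hl | hl
        · obtain ⟨w, q, hwv, rfl⟩ : ∃ (w : Fin (I x).n)
              (q : ((I x).G.within (I x).active).Walk (u x) w)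
              (hwv : ((I x).G.within (I x).active).Adj w v), p = q.concat hwv := by
            cases p with
            | nil => simp at hl
            | cons hadj p => exact SimpleGraph.Walk.exists_cons_eq_concat hadj p
          rw [SimpleGraph.Walk.length_concat] at hp
          exact Or.inr ⟨w, (ih w).2 ⟨q, by omega⟩, hwv.1, hwv.2⟩
        · exact Or.inl ((ih v).2 ⟨p, hl⟩)
  rw [key]
  constructor
  · rintro ⟨p, -⟩
    exact p.reachable
  · rintro ⟨p⟩
    -- A walk shortens to a path, which has fewer than `n` edges, so `n` rounds suffice.
    exact ⟨p.bypass, by simpa using (p.bypass_isPath.length_lt).le⟩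

end Avail

end Inst

/-! ## The algorithm -/

open Inst

/-- A program solving all instances of a class defines an optimum solution for each of them. -/
theorem SolvableInPolyTime.exists_solver {k : ℕ} {H : SimpleGraph (Fin k)}
    {𝒞 : ∀ n : ℕ, SimpleGraph (Fin n) → Prop} (h : SolvableInPolyTime H 𝒞) :
    ∃ ω : ∀ I : Inst k 𝒞, I.Coloring,
      (PT (fun I : Inst k 𝒞 => I.n) enc fun I => encodeColoring (ω I)) ∧
      ∀ I, IsOptimumSolution I.G H I.rev (ω I) := by
  obtain ⟨P, p, h⟩ := h
  choose ω T hω hrun hT using fun I : Inst k 𝒞 => h I.n I.G I.rev I.mem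
  exact ⟨ω, ⟨P, p, fun I => ⟨T I, hrun I, hT I⟩⟩, hω⟩

section Algorithm

variable {k s t : ℕ} {VF : Type*} {F : SimpleGraph VF} {H : SimpleGraph (Fin k)}

/-- Instances whose graphs exclude the antenna. -/
abbrev AntennaInst (k s t : ℕ) {VF : Type*} (F : SimpleGraph VF) :=
  Inst k fun _ G => ForbidFree s t (antenna F) G

/-- The instances solved within the closed neighbourhood of `p` for a vertex `q` of it. -/
noncomputable def AntennaInst.oracle [Nontrivial VF] (hF : F.Connected) (I : AntennaInst k s t F)
    (p q : Fin I.n) : Inst k fun _ G => ForbidFree s t F G :=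
  -- The last conjunct does not depend on `v`: it leaves nothing active unless `q` is in the closed
  -- neighbourhood of `p`. Thus the graph is in the class for all `p` and `q`, right guesses or not.
  let J := I.mask fun v _ => (v = p ∨ I.G.Adj p v) ∧ ¬ I.G.Adj q v ∧ (q = p ∨ I.G.Adj p q)
  { n := I.n
    G := I.G.within J.active
    rev := J.rev
    mem := forbidFree_within hF I.mem fun _ hv => (active_mask.1 hv).choose_spec.1 }

/-- Instances in a closed neighbourhood: some vertex `q` in the solution is guessed with its color;
outside the neighbourhood of `q` the graph is `F`-free, inside there is one color less. -/
theorem exists_star_solver [Nontrivial VF] (hF : F.Connected)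
    (h : SolvableInPolyTime H fun _ G => ForbidFree s t F G) {i : ℕ}
    {σ : ∀ I : AntennaInst k s t F, I.Coloring}
    (hσ : PT (fun I : AntennaInst k s t F => I.n) enc fun I => encodeColoring (σ I))
    (hsafe : ∀ I, Safe H I (σ I)) (hopt : ∀ I, I.live.card ≤ i → Opt H I (σ I)) :
    ∃ τ : ∀ I : AntennaInst k s t F, Fin I.n → I.Coloring,
      (PT (X := Σ I : AntennaInst k s t F, Fin I.n) (fun y => y.1.n) (PT.withFin enc fun I => I.n)
        fun y => encodeColoring (τ y.1 y.2)) ∧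
      (∀ (I : AntennaInst k s t F) p, I.Safe H (τ I p)) ∧
      ∀ (I : AntennaInst k s t F) p, I.live.card ≤ i + 1 → (∀ v ∈ I.active, v = p ∨ I.G.Adj p v) → I.Opt H (τ I p) := by
  obtain ⟨ω, hω, hωopt⟩ := h.exists_solver
  obtain ⟨m, hm⟩ := exists_announcement (𝒞 := fun _ G => ForbidFree s t (antenna F) G) H s t
  have hI : Avail (fun I : AntennaInst k s t F => I.n) enc fun I => I :=
    ⟨PB.of_le fun _ => le_rfl, PT.id _ _⟩
  have hIp := hI.up fun I => I.n
  have hIq := hIp.up fun y => y.1.n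
  have hIc := hIq.up fun _ => k
  let W := Σ z : (Σ y : (Σ I : AntennaInst k s t F, Fin I.n), Fin y.1.n), Fin k
  let e : W → Val := PT.withFin (PT.withFin (PT.withFin enc
    fun I : AntennaInst k s t F => I.n) fun y => y.1.n) fun _ => k
  -- The open neighbourhood of the guessed `q`; thus `q` itself is left to the outer side.
  let A : ∀ w : W, Set (Fin w.1.1.1.n) := fun w => {v | w.1.1.1.G.Adj w.1.2 v}
  let φ : ∀ w : W, w.1.1.1.Table → w.1.1.1.Coloring := fun w M =>
    σ ((w.1.1.1.mask M).mask fun _ c => c ≠ w.2)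
  let ψ : ∀ w : W, w.1.1.1.Table → w.1.1.1.Coloring := fun w M =>
    ω (AntennaInst.oracle hF (w.1.1.1.mask M) w.1.1.2 w.1.2)
  have hψopt : ∀ (w : W) M, Opt H ((w.1.1.1.mask M).mask fun v _ =>
      (v = w.1.1.2 ∨ w.1.1.1.G.Adj w.1.1.2 v) ∧ ¬ w.1.1.1.G.Adj w.1.2 v ∧
        (w.1.2 = w.1.1.2 ∨ w.1.1.1.G.Adj w.1.1.2 w.1.2)) (ψ w M) := fun w M =>
    opt_of_isOptimumSolution (hωopt (AntennaInst.oracle hF (w.1.1.1.mask M) w.1.1.2 w.1.2))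
  have hM := Avail.ofMask (e := e) hIc.bound
  have hφPT : PT (X := Σ w : W, w.1.1.1.Table) (fun y => y.1.1.1.1.n)
      (Avail.withMask e fun w : W => w.1.1.1) fun y => encodeColoring (φ y.1 y.2) := by
    refine hσ.call (φ := fun y : Σ w : W, w.1.1.1.Table =>
      (y.1.1.1.1.mask y.2).mask fun _ c => c ≠ y.1.2) (hM.mask (PD.not ?_)).enc fun _ => le_rfl
    refine PD.fin_eq (n := fun _ => k) (PB.const _ k) (PT.last _ _ _) ?_
    exact (((PT.last _ _ fun w : W => w.1.1.1.n).weaken (fun y : Σ w : W, w.1.1.1.Table => y.1)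
      fun y => (y.1.1.1.1.mask y.2).enc).up fun y => y.1.1.1.1.n).up fun _ => k
  have hψPT : PT (X := Σ w : W, w.1.1.1.Table) (fun y => y.1.1.1.1.n)
      (Avail.withMask e fun w : W => w.1.1.1) fun y => encodeColoring (ψ y.1 y.2) := by
    refine hω.call (φ := fun y : Σ w : W, w.1.1.1.Table =>
      AntennaInst.oracle hF (y.1.1.1.1.mask y.2) y.1.1.1.2 y.1.1.2)
      (Avail.within (hM.mask ?_)) fun _ => le_rfl
    have hp := (((PT.last₂ enc (fun I : AntennaInst k s t F => I.n) (fun y => y.1.n) (fun _ => k)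
      fun y => y.1.1.1.n).weaken (fun y : Σ w : W, w.1.1.1.Table => y.1)
      fun y => (y.1.1.1.1.mask y.2).enc).up fun y => y.1.1.1.1.n).up fun _ => k
    have hq := (((PT.last₁ (PT.withFin enc fun I : AntennaInst k s t F => I.n) (fun y => y.1.n) (fun _ => k)
      fun y => y.1.1.1.n).weaken (fun y : Σ w : W, w.1.1.1.Table => y.1)
      fun y => (y.1.1.1.1.mask y.2).enc).up fun y => y.1.1.1.1.n).up fun _ => k
    have hM2 := (hM.up fun y => y.1.1.1.1.n).up fun _ => k
    exact PD.and (PD.or (hM2.vertex_eq (PT.last₁ _ _ _ _) hp) (hM2.adj hp (PT.last₁ _ _ _ _)))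
      (PD.and (PD.not (hM2.adj hq (PT.last₁ _ _ _ _)))
        (PD.or (hM2.vertex_eq hq hp) (hM2.adj hp hq)))
  obtain ⟨χ, hχ, hχm⟩ := hIc.exists_split H (A := A)
    ((hIc.up _).adj (PT.last₂ _ _ _ _ _) (PT.last _ _ _)) hφPT hψPT m
  have hφsafe : ∀ (w : W) M, (w.1.1.1.mask M).Safe H (φ w M) := fun w M =>
    (safe_mask.1 (hsafe ((w.1.1.1.mask M).mask fun _ c => c ≠ w.2))).1
  have hψsafe : ∀ (w : W) M, (w.1.1.1.mask M).Safe H (ψ w M) := fun w M =>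
    (safe_mask.1 (hψopt w M).1).1
  have hχsafe : ∀ w : W, w.1.1.1.Safe H (χ w) := by
    intro w
    obtain ⟨Z, hZ⟩ := (hχm w).1
    rw [hZ]
    exact safe_combine (hφsafe _ _) (hψsafe _ _)
  obtain ⟨χ₁, hχ₁, h₁⟩ := hIq.exists_best (n := fun _ => k) (PT.encodeNat_const _ _ k)
    (PB.const _ k) hIq.none (φ := fun z c => χ ⟨z, c⟩) hχ
  obtain ⟨τ, hτ, h₂⟩ := hIp.exists_best hIp.size hIp.bound hIp.none (φ := fun y q => χ₁ ⟨y, q⟩) hχ₁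
  have hχ₁safe : ∀ z : (Σ y : (Σ I : AntennaInst k s t F, Fin I.n), Fin y.1.n), z.1.1.Safe H (χ₁ z) := by
    intro z
    rcases (h₁ z).1 with h | ⟨c, h⟩ <;> rw [h]
    · exact safe_none
    · exact hχsafe ⟨z, c⟩
  have hτsafe : ∀ y : (Σ I : AntennaInst k s t F, Fin I.n), y.1.Safe H (τ y) := by
    intro y
    rcases (h₂ y).1 with h | ⟨c, h⟩ <;> rw [h]
    · exact safe_none
    · exact hχ₁safe ⟨y, c⟩
  refine ⟨fun I p => τ ⟨I, p⟩, hτ, fun I p => hτsafe ⟨I, p⟩, fun I p hlive hp => ?_⟩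
  obtain ⟨ρ, hρ⟩ := I.exists_opt H
  refine opt_of_revenue_le hρ (hτsafe ⟨I, p⟩) ?_
  -- If the optimum colors nothing there is no `q` to guess; the empty coloring is the initial
  -- candidate of both searches.
  by_cases hρ0 : ρ = fun _ => none
  · rw [hρ0]
    exact (h₂ ⟨I, p⟩).2.1
  obtain ⟨q, c, hqc⟩ : ∃ q c, ρ q = some c := by
    by_contra! hno
    exact hρ0 (funext fun v => Option.eq_none_iff_forall_ne_some.2 fun c => hno v c)
  let w : W := ⟨⟨⟨I, p⟩, q⟩, c⟩
  obtain ⟨D, hDm, hDin, hDout⟩ := hm I I.mem.2.1 I.mem.2.2.1 (A w) q (fun v hv => Or.inr hv)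
    (fun v hv => hv) ρ hρ.1
  refine le_trans ?_ ((((hχm w).2 D hDm).trans ((h₁ ⟨⟨I, p⟩, q⟩).2.2 c)).trans
    ((h₂ ⟨I, p⟩).2.2 q))
  have hres : ∀ B : Set (Fin I.n), I.Safe H (combine B ρ fun _ => none) := fun B =>
    hρ.1.of_le fun v c hv => (combine_none_eq_some.1 hv).2
  refine opt_combine (I := I) (hφsafe w _) (hψsafe w _) ?_ ?_
  · refine opt_mask_mask (hopt _ ?_) (hres _) hDin ?_
    · have hc : c ∈ I.live := by simpa [live] using ⟨q, hρ.1.2 q c hqc⟩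
      have : (((I.mask (I.innerMask (A w) (I.announce D))).mask fun _ c' => c' ≠ c)).live ⊆
          I.live.erase c := by
        intro c' hc'
        exact Finset.mem_erase.2 ⟨(live_mask.1 hc').choose_spec.1,
          live_mask_subset _ (live_mask_subset _ hc')⟩
      have := Finset.card_le_card this
      rw [Finset.card_erase_of_mem hc] at this
      exact this.trans (by omega)
    -- A neighbour of `q` with color `c` would require a loop of `H` at `c`.
    · intro v c' hv hcc
      obtain ⟨hvA, hv'⟩ := combine_none_eq_some.1 hv
      exact H.loopless.irrefl _ (hρ.1.1 q v c c hqc (hv'.trans (congrArg some hcc)) hvA)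
  · refine opt_mask_mask (hψopt w _) (hres _) hDout fun v c' hv => ?_
    obtain ⟨hvA, hv⟩ := combine_none_eq_some.1 hv
    exact ⟨hp v (hρ.1.mem_active hv), hvA, hp q (hρ.1.mem_active hqc)⟩

/-- Instances that can be peeled in `j` rounds are solved by guessing, in each component of the
active subgraph, the next closed neighbourhood to remove. -/
theorem exists_peeling_solver [Nontrivial VF] (hF : F.Connected)
    (h : SolvableInPolyTime H fun _ G => ForbidFree s t F G) {i : ℕ}
    {σ : ∀ I : AntennaInst k s t F, I.Coloring}
    (hσ : PT (fun I : AntennaInst k s t F => I.n) enc fun I => encodeColoring (σ I))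
    (hsafe : ∀ I, Safe H I (σ I)) (hopt : ∀ I, I.live.card ≤ i → Opt H I (σ I)) (j : ℕ) :
    ∃ κ : ∀ I : AntennaInst k s t F, I.Coloring,
      (PT (fun I : AntennaInst k s t F => I.n) enc fun I => encodeColoring (κ I)) ∧
      (∀ I : AntennaInst k s t F, I.Safe H (κ I)) ∧
      ∀ I : AntennaInst k s t F, I.live.card ≤ i + 1 → I.G.Peelable j I.active → I.Opt H (κ I) := by
  obtain ⟨τ, hτ, hτsafe, hτopt⟩ := exists_star_solver hF h hσ hsafe hopt
  obtain ⟨m, hm⟩ := exists_announcement (𝒞 := fun _ G => ForbidFree s t (antenna F) G) H s t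
  have hI : Avail (fun I : AntennaInst k s t F => I.n) enc fun I => I :=
    ⟨PB.of_le fun _ => le_rfl, PT.id _ _⟩
  have hIp := hI.up fun I => I.n
  induction j with
  | zero => exact ⟨_, hI.none, fun I => safe_none, fun I _ hj => opt_of_active_eq_empty hj safe_none⟩
  | succ j ih =>
    obtain ⟨κ, hκ, hκsafe, hκopt⟩ := ih
    let W := Σ I : AntennaInst k s t F, Fin I.n
    -- Here `A` is the closed neighbourhood of the guessed centre: the star solver `τ` treats the
    -- inside, and `κ`, with `j` rounds, the outside.
    let A : ∀ w : W, Set (Fin w.1.n) := fun w => {v | v = w.2 ∨ w.1.G.Adj w.2 v}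
    let φ : ∀ w : W, w.1.Table → w.1.Coloring := fun w M => τ (w.1.mask M) w.2
    let ψ : ∀ w : W, w.1.Table → w.1.Coloring := fun w M => κ (w.1.mask M)
    have hM := Avail.ofMask (e := PT.withFin enc fun I : AntennaInst k s t F => I.n) hIp.bound
    have hφPT : PT (X := Σ w : W, w.1.Table) (fun y => y.1.1.n)
        (Avail.withMask (PT.withFin enc fun I => I.n) fun w : W => w.1) fun y => encodeColoring (φ y.1 y.2) :=
      hτ.call (φ := fun y : Σ w : W, w.1.Table => (⟨y.1.1.mask y.2, y.1.2⟩ : W))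
        (hM.enc.pair ((PT.last enc (fun I => I.n) fun w : W => w.1.n).weaken
          (fun y : Σ w : W, w.1.Table => y.1) fun y => (y.1.1.mask y.2).enc))
        fun _ => le_rfl
    have hψPT : PT (X := Σ w : W, w.1.Table) (fun y => y.1.1.n)
        (Avail.withMask (PT.withFin enc fun I => I.n) fun w : W => w.1) fun y => encodeColoring (ψ y.1 y.2) :=
      hκ.call (φ := fun y : Σ w : W, w.1.Table => y.1.1.mask y.2) hM.enc fun _ => le_rfl
    obtain ⟨χ, hχ, hχm⟩ := hIp.exists_split H (A := A)
      (((hIp.up _).vertex_eq (PT.last _ _ _) (PT.last₁ _ _ _ _)).or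
        ((hIp.up _).adj (PT.last₁ _ _ _ _) (PT.last _ _ _))) hφPT hψPT m
    have hχsafe : ∀ w : W, w.1.Safe H (χ w) := by
      intro w
      obtain ⟨Z, hZ⟩ := (hχm w).1
      rw [hZ]
      exact safe_combine (hτsafe (w.1.mask _) w.2) (hκsafe (w.1.mask _))
    obtain ⟨π, hπ, h₁⟩ := hI.exists_best hI.size hI.bound hI.none (φ := fun I p => χ ⟨I, p⟩) hχ
    have hπsafe : ∀ I : AntennaInst k s t F, I.Safe H (π I) := by
      intro I
      rcases (h₁ I).1 with h | ⟨c, h⟩ <;> rw [h]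
      · exact safe_none
      · exact hχsafe ⟨I, c⟩
    -- `π` tries every centre `p` without passing to components, so it needs one `p` that works for
    -- the entire active set. Restricting to a component provides it.
    have hπopt : ∀ I : AntennaInst k s t F, I.live.card ≤ i + 1 →
        (∃ p, I.G.Peelable j {v ∈ I.active | v ≠ p ∧ ¬ I.G.Adj p v}) → I.Opt H (π I) := by
      rintro I hlive ⟨p, hp⟩
      obtain ⟨ρ, hρ⟩ := I.exists_opt H
      refine opt_of_revenue_le hρ (hπsafe I) ?_
      let w : W := ⟨I, p⟩
      obtain ⟨D, hDm, hDin, hDout⟩ := hm I I.mem.2.1 I.mem.2.2.1 (A w) p (fun v hv => hv)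
        (fun v hv h => hv (Or.inr h)) ρ hρ.1
      refine le_trans ?_ (((hχm w).2 D hDm).trans ((h₁ I).2.2 p))
      have hres : ∀ B : Set (Fin I.n), I.Safe H (combine B ρ fun _ => none) := fun B =>
        hρ.1.of_le fun v c hv => (combine_none_eq_some.1 hv).2
      refine opt_combine (hτsafe (I.mask _) p) (hκsafe (I.mask _)) ?_ ?_
      · refine opt_mask (hτopt (I.mask _) p ?_ ?_) (hres _) hDin
        · exact (Finset.card_le_card (live_mask_subset _)).trans hlive
        · exact fun v hv => (active_mask.1 hv).choose_spec.1.1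
      · refine opt_mask (hκopt (I.mask _) ?_ (hp.mono ?_)) (hres _) hDout
        · exact (Finset.card_le_card (live_mask_subset _)).trans hlive
        · intro v hv
          obtain ⟨c, ⟨hvA, -⟩, hc⟩ := active_mask.1 hv
          exact ⟨⟨c, hc⟩, fun h => hvA (Or.inl h), fun h => hvA (Or.inr h)⟩
    have hcomp : Avail (X := W) (fun w => w.1.n) (PT.withFin enc fun I => I.n)
        fun w => w.1.mask (w.1.compMask w.2) :=
      hIp.mask (((hIp.up _).up _).mem_reach (PT.last₂ _ _ _ _ _) (PT.last₁ _ _ _ _))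
    -- Every vertex takes its color from the solution of its own component, so no list of components
    -- has to be formed.
    refine ⟨fun I u => π (I.mask (I.compMask u)) u, ?_, fun I => ?_, fun I hlive hj => ?_⟩
    · exact PT.coloring (φ := fun (I : AntennaInst k s t F) u => π (I.mask (I.compMask u)) u)
        hI.size hI.bound (PT.color (φ := fun w : W => π (w.1.mask (w.1.compMask w.2)))
          hIp.bound (hπ.call (φ := fun w : W => w.1.mask (w.1.compMask w.2)) hcomp.enc
            fun _ => le_rfl) (PT.last _ _ _))
    · exact safe_components (ψ := fun u => π (I.mask (I.compMask u)))
        (fun u => (safe_mask.1 (hπsafe (I.mask (I.compMask u)))).1)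
        fun u v huv => by rw [huv]
    · refine opt_components (ψ := fun u => π (I.mask (I.compMask u))) (fun u => ?_)
        fun u v huv => by rw [huv]
      by_cases hu : u ∈ I.active
      · obtain ⟨p, hp⟩ := hj u hu
        refine hπopt (I.mask _) ((Finset.card_le_card (live_mask_subset _)).trans hlive)
          ⟨p, hp.mono fun v hv => ⟨?_, hv.2⟩⟩
        exact (active_mask.1 hv.1).choose_spec.1
      -- An inactive `u` is alone in its component, so this mask leaves no active vertex.
      · refine opt_of_active_eq_empty (Set.eq_empty_iff_forall_notMem.2 fun v hv => hu ?_)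
          (hπsafe _)
        obtain ⟨c, hvu, hc⟩ := active_mask.1 hv
        exact SimpleGraph.mem_of_mem_reach (G := I.G) (C := I.active) (u := v) ⟨c, hc⟩
          (SimpleGraph.Reachable.symm hvu)

/-- Instances with at most `i` live colors. -/
theorem exists_solver [Nontrivial VF] (hF : F.Connected)
    (h : SolvableInPolyTime H fun _ G => ForbidFree s t F G) (i : ℕ) :
    ∃ σ : ∀ I : AntennaInst k s t F, I.Coloring,
      (PT (fun I : AntennaInst k s t F => I.n) enc fun I => encodeColoring (σ I)) ∧
      (∀ I : AntennaInst k s t F, I.Safe H (σ I)) ∧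
      ∀ I : AntennaInst k s t F, I.live.card ≤ i → I.Opt H (σ I) := by
  induction i with
  | zero =>
    have hI : Avail (fun I : AntennaInst k s t F => I.n) enc fun I => I :=
      ⟨PB.of_le fun _ => le_rfl, PT.id _ _⟩
    refine ⟨_, hI.none, fun I => safe_none, fun I hlive => opt_of_active_eq_empty ?_ safe_none⟩
    have hlive := Finset.card_eq_zero.1 (Nat.le_zero.1 hlive)
    refine Set.eq_empty_iff_forall_notMem.2 fun v ⟨c, hc⟩ => ?_
    have : c ∈ I.live := by simpa [live] using ⟨v, hc⟩
    simp [hlive] at this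
  | succ i ih =>
    obtain ⟨σ, hσ, hsafe, hopt⟩ := ih
    -- Five rounds, since the excluded path has `5 + 1` vertices.
    obtain ⟨κ, hκ, hκsafe, hκopt⟩ := exists_peeling_solver hF h hσ hsafe hopt 5
    exact ⟨κ, hκ, hκsafe, fun I hlive =>
      hκopt I hlive (SimpleGraph.peelable_of_pathGraph_free I.mem.1 _)⟩

end Algorithm

theorem mainTheorem10 (s t : ℕ) {VF : Type*} [Finite VF] [Nontrivial VF]
    (F : SimpleGraph VF) (hF : F.Connected)
    (h : ∀ (k : ℕ) (H : SimpleGraph (Fin k)),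
      SolvableInPolyTime H (fun _ G => ForbidFree s t F G)) :
    ∀ (k : ℕ) (H : SimpleGraph (Fin k)),
      SolvableInPolyTime H (fun _ G => ForbidFree s t (antenna F) G) := by
  intro k H
  -- There are only `k` colors, so the bound `k` on the live ones always holds.
  obtain ⟨σ, ⟨P, p, hP⟩, -, hopt⟩ := exists_solver hF (h k H) k
  refine ⟨P, p, fun n G rev hG => ?_⟩
  obtain ⟨T, hT, hTp⟩ := hP ⟨n, G, rev, hG⟩
  exact ⟨σ ⟨n, G, rev, hG⟩, T,
    (hopt ⟨n, G, rev, hG⟩ ((Finset.card_le_univ _).trans (by simp))).isOptimumSolution, hT, hTp⟩
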